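/- **Setting.** Let $K$ users be given, with $N_i$ antennas at transmitter $i$, $M_i$ antennas at receiver $i$ and $d_i$ data streams. The channel matrices $\mathbf H_{ji}\in\mathbb C^{M_j\times N_i}$ have i.i.d. $\mathcal{CN}(0,1)$ entries. A *feedback profile* $\mathcal L$ consists of integers $0\le M_j^s\le M_j$, $0\le N_i^s\le N_i$ and, for every $j$, a partition of $\{1,\dots,K\}\setminus\{j\}$ into $\Omega_j^{I},\Omega_j^{II},\Omega_j^{III},\Omega_j^{IV}$. Put $$M_j^e=M_j^s-\sum_{i\in\Omega_j^{II}}N_i^s,\qquad N_i^e=N_i^s-\sum_{j:\,i\in\Omega_j^{III}}M_j^e,\qquad d_j^0=d_j+\sum_{i\in\Omega_j^{I}}d_i,$$ and let $\mathbf H_{ji}^s$ be the upper left $M_j^s\times N_i^s$ submatrix of $\mathbf H_{ji}$. Let $\mathbf S_j^r\in\mathbb C^{M_j^s\times M_j^e}$ have orthonormal columns spanning the left null space of $[\cdots\,\mathbf H_{ji}^s\,\cdots]_{i\in\Omega_j^{II}}$, and let $\mathbf S_i^t\in\mathbb C^{N_i^s\times N_i^e}$ have orthonormal columns spanning $\bigcap_{j:\,i\in\Omega_j^{III}}\ker\big((\mathbf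 S_j^r)^\dagger\mathbf H_{ji}^s\big)$. Receiver $j$ feeds back $$F_j=\Big(\big(\ker((\mathbf S_j^r)^\dagger\mathbf H_{jp}^s)\big)_{p\in\Omega_j^{III}},\ \operatorname{span}\big([\cdots\,(\mathbf S_j^r)^\dagger\mathbf H_{jq}^s\,\cdots]_{q\in\Omega_j^{IV}}^T\big)\Big).$$ *Problem 1* asks for precoders $\mathbf V_i\in\mathbb C^{N_i\times d_i}$ that are functions of $(F_1,\dots,F_K)$ only, and decorrelators $\mathbf U_j\in\mathbb C^{M_j\times d_j}$ that are functions of $(\mathbf H_{ji}\mathbf V_i)_i$, such that $\operatorname{rank}(\mathbf U_j^\dagger\mathbf H_{jj}\mathbf V_j)=d_j$ for all $j$ and $\mathbf U_j^\dagger\mathbf H_{ji}\mathbf V_i=\mathbf 0$ for all $i\ne j$. It is *feasible almost surely (with the prescribed structure)* if there are such functions for which, for almost every channel, the matrices $\mathbf S_j^r,\mathbf S_i^t$ exist, these conditions hold, $\mathbf V_i=\begin{bmatrix}\mathbf S_i^t\mathbf V_i^a\\ \mathbf 0\end{bmatrix}$ for some $\mathbf V_i^a\in\mathbb C^{N_i^e\times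 d_i}$, and, for any invertible $\mathbf R_j\in\mathbb C^{M_j^e\times M_j^e}$, the same conditions are also met with these $\mathbf V_i$ by decorrelators of the form $\begin{bmatrix}\mathbf S_j^r\mathbf R_j^\dagger\mathbf U_j^a\\ \mathbf 0\end{bmatrix}$ with $\mathbf U_j^a\in\mathbb C^{M_j^e\times d_j}$. Assume $N_i^e\ge d_i$ and $M_i^e\ge d_i^0$ for all $i$. With $\mathbf R_j$ invertible, write $$\mathbf G_{ji}=\mathbf R_j(\mathbf S_j^r)^\dagger\mathbf H_{ji}^s\mathbf S_i^t=\begin{bmatrix}\mathbf G_{ji}^{(1)}&\mathbf G_{ji}^{(3)}\\ \mathbf G_{ji}^{(2)}&\mathbf G_{ji}^{(4)}\end{bmatrix},\qquad \mathbf G_{ji}^{(1)}\in\mathbb C^{d_j^0\times d_i},$$ and for $i\in\Omega_j^{IV}$ let $\mathbf X_{ji}$ be the matrix with $d_id_j^0$ rows and $\sum_{p}d_p^0(M_p^e-d_p^0)+\sum_q d_q(N_q^e-d_q)$ columns, divided into successive column blocks of widths $d_1^0(M_1^e-d_1^0),\dots,d_K^0(M_K^e-d_K^0),d_1(N_1^e-d_1),\dots,d_K(N_K^e-d_K)$,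 whose $j$-th block is $(\mathbf G_{ji}^{(2)})^T\otimes\mathbf I_{d_j^0}$, whose $(K+i)$-th block is $\mathbf I_{d_i}\otimes\mathbf G_{ji}^{(3)}$, and whose other blocks are zero. Say that *independence holds* at a channel realization if, for some $\mathbf S_j^r,\mathbf S_i^t$ belonging to it and some invertible $\mathbf R_j$, the rows of all the matrices $\mathbf X_{ji}$ ($i\in\Omega_j^{IV}$, all $j$) together are linearly independent. **Theorem.** 1. If independence holds, then Problem 1 is feasible almost surely: there are functions as in Problem 1 that, for almost every channel at which independence holds, solve it with the prescribed structure. 2. Independence is a generic property: either it holds at almost every channel, or it fails at almost every channel. In the first case, the rows of the $\mathbf X_{ji}$ with $\mathbf R_j=\mathbf I$ are moreover linearly independent almost surely for every measurable rule that computes $\mathbf S_j^r,\mathbf S_i^t$ from the channels $\mathbf H_{ji}$, $i\in\Omega_j^{II}\cup\Omega_j^{III}$. 3. If independence holds at one channel realization, then it holds at almost every channel, and Problem 1 is feasible almost surely. -/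

import Mathlib

open MeasureTheory ProbabilityTheory
open scoped Matrix Kronecker

noncomputable section

namespace IA

/-! ### The network and the channel -/

/-- The standard circularly symmetric complex Gaussian law (zero mean, unit variance):
independent real and imaginary parts, each of variance `1/2`. -/
def stdComplexGaussian : Measure ℂ :=
  ((gaussianReal 0 (1 / 2)).prod (gaussianReal 0 (1 / 2))).map
    (fun z : ℝ × ℝ => (z.1 : ℂ) + (z.2 : ℂ) * Complex.I)

/-- Channel realizations: `H j i` is the `M j × N i` fading matrix from Tx `i` to Rx `j`. -/
abbrev Channel {K : ℕ} (M N : Fin K → ℕ) : Type :=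
  ∀ j i : Fin K, Fin (M j) → Fin (N i) → ℂ

/-- The law of the channel: all entries of all `H j i` are i.i.d. standard complex Gaussian. -/
def channelLaw {K : ℕ} (M N : Fin K → ℕ) : Measure (Channel M N) :=
  Measure.pi fun _ => Measure.pi fun _ => Measure.pi fun _ => Measure.pi fun _ =>
    stdComplexGaussian

/-! ### Linear algebra notions -/

/-- The span of the columns of a matrix. -/
def colSpan {m n : Type*} (A : Matrix m n ℂ) : Submodule ℂ (m → ℂ) :=
  Submodule.span ℂ (Set.range fun c : n => fun r : m => A r c)

/-- The null space `{u | A u = 0}`. -/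
def nullSpace {m n : Type*} [Fintype n] (A : Matrix m n ℂ) : Submodule ℂ (n → ℂ) :=
  LinearMap.ker A.mulVecLin

/-- The left null space `{u | u† A = 0}`, i.e. `{u | A† u = 0}`. -/
def leftNullSpace {m n : Type*} [Fintype m] (A : Matrix m n ℂ) : Submodule ℂ (m → ℂ) :=
  LinearMap.ker Aᴴ.mulVecLin

/-- Append zero rows below (if `n ≤ n'`). -/
def padRows {n k : ℕ} (n' : ℕ) (A : Matrix (Fin n) (Fin k) ℂ) : Matrix (Fin n') (Fin k) ℂ :=
  Matrix.of fun r c => if h : (r : ℕ) < n then A ⟨r, h⟩ c else 0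

/-- The first `a` of `b` indices. -/
def firstIdx {a b : ℕ} (h : a ≤ b) : Fin a → Fin b := Fin.castLE h

/-- The last `b - a` of `b` indices. -/
def lastIdx {a b : ℕ} (h : a ≤ b) : Fin (b - a) → Fin b :=
  fun x => ⟨a + x, by have := x.2; omega⟩

/-! ### Feedback profiles -/

/-- A feedback profile: the sizes of the channel submatrices that are used, and for every Rx `j`
a partition of its cross links `{i | i ≠ j}` into the four feedback strategies. -/
structure Profile {K : ℕ} (M N : Fin K → ℕ) where
  Ms : Fin K → ℕ
  Ns : Fin K → ℕ
  Ms_le : ∀ j, Ms j ≤ M j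
  Ns_le : ∀ i, Ns i ≤ N i
  ΩI : Fin K → Finset (Fin K)
  ΩII : Fin K → Finset (Fin K)
  ΩIII : Fin K → Finset (Fin K)
  ΩIV : Fin K → Finset (Fin K)
  cover : ∀ j, ΩI j ∪ ΩII j ∪ ΩIII j ∪ ΩIV j = Finset.univ.erase j
  disj_I_II : ∀ j, Disjoint (ΩI j) (ΩII j)
  disj_I_III : ∀ j, Disjoint (ΩI j) (ΩIII j)
  disj_I_IV : ∀ j, Disjoint (ΩI j) (ΩIV j)
  disj_II_III : ∀ j, Disjoint (ΩII j) (ΩIII j)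
  disj_II_IV : ∀ j, Disjoint (ΩII j) (ΩIV j)
  disj_III_IV : ∀ j, Disjoint (ΩIII j) (ΩIV j)

namespace Profile

variable {K : ℕ} {M N : Fin K → ℕ} (L : Profile M N) (d : Fin K → ℕ)

/-- `M_j^e = M_j^s - ∑_{i ∈ Ω_j^II} N_i^s`, an integer. -/
def Me (j : Fin K) : ℤ := (L.Ms j : ℤ) - ∑ i ∈ L.ΩII j, (L.Ns i : ℤ)

/-- `N_i^e = N_i^s - ∑_{j : i ∈ Ω_j^III} M_j^e`, an integer. -/
def Ne (i : Fin K) : ℤ := (L.Ns i : ℤ) - ∑ j with i ∈ L.ΩIII j, L.Me j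

/-- `M_j^e` as a matrix dimension (used only when it is nonnegative). -/
def me (j : Fin K) : ℕ := (L.Me j).toNat

/-- `N_i^e` as a matrix dimension (used only when it is nonnegative). -/
def ne (i : Fin K) : ℕ := (L.Ne i).toNat

/-- `d_j^0 = d_j + ∑_{i ∈ Ω_j^I} d_i`. -/
def d0 (j : Fin K) : ℕ := d j + ∑ i ∈ L.ΩI j, d i

/-- The submatrix `H_{ji}^s`: the first `M_j^s` rows and first `N_i^s` columns of `H_{ji}`. -/
def Hs (H : Channel M N) (j i : Fin K) : Matrix (Fin (L.Ms j)) (Fin (L.Ns i)) ℂ :=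
  (Matrix.of (H j i)).submatrix (firstIdx (L.Ms_le j)) (firstIdx (L.Ns_le i))

/-- The concatenation `[⋯ H_{ji}^s ⋯]` over `i ∈ Ω_j^II`. -/
def concatII (H : Channel M N) (j : Fin K) :
    Matrix (Fin (L.Ms j)) (Σ i : {i // i ∈ L.ΩII j}, Fin (L.Ns i)) ℂ :=
  Matrix.of fun r c => L.Hs H j c.1 r c.2

/-- Families of matrices `S_j^r`, of size `M_j^s × M_j^e`. -/
abbrev RxFrames : Type := ∀ j : Fin K, Matrix (Fin (L.Ms j)) (Fin (L.me j)) ℂ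

/-- Families of matrices `S_i^t`, of size `N_i^s × N_i^e`. -/
abbrev TxFrames : Type := ∀ i : Fin K, Matrix (Fin (L.Ns i)) (Fin (L.ne i)) ℂ

/-- `S_j^r` has orthonormal columns that span the left null space of the strategy II links. -/
def IsRxFrames (H : Channel M N) (Sr : L.RxFrames) : Prop :=
  ∀ j, (Sr j)ᴴ * Sr j = 1 ∧ colSpan (Sr j) = leftNullSpace (L.concatII H j)

/-- `S_i^t` has orthonormal columns that span the intersection of the null spaces of the
matrices `(S_j^r)† H_{ji}^s` over all `j` with `i ∈ Ω_j^III`. -/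
def IsTxFrames (H : Channel M N) (Sr : L.RxFrames) (St : L.TxFrames) : Prop :=
  ∀ i, (St i)ᴴ * St i = 1 ∧
    colSpan (St i) = ⨅ j : {j // i ∈ L.ΩIII j}, nullSpace ((Sr j)ᴴ * L.Hs H j i)

/-- `(Sr, St)` are matrices `S_j^r`, `S_i^t` for the channel realization `H`. -/
def IsFrames (H : Channel M N) (Sr : L.RxFrames) (St : L.TxFrames) : Prop :=
  L.IsRxFrames H Sr ∧ L.IsTxFrames H Sr St

/-! ### The CSI feedback -/

/-- The values of the feedback function of Rx `j`: one subspace of `ℂ^{N_p^s}` for each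
`p ∈ Ω_j^III`, and one subspace of `ℂ^{∑_{q ∈ Ω_j^IV} N_q^s}`. -/
abbrev Feedback (j : Fin K) : Type :=
  (∀ p : {p // p ∈ L.ΩIII j}, Submodule ℂ (Fin (L.Ns p) → ℂ)) ×
    Submodule ℂ ((Σ q : {q // q ∈ L.ΩIV j}, Fin (L.Ns q)) → ℂ)

/-- The concatenation `[⋯ (S_j^r)† H_{jq}^s ⋯]` over `q ∈ Ω_j^IV`. -/
def concatIV (H : Channel M N) (Sr : L.RxFrames) (j : Fin K) :
    Matrix (Fin (L.me j)) (Σ q : {q // q ∈ L.ΩIV j}, Fin (L.Ns q)) ℂ :=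
  Matrix.of fun r c => ((Sr j)ᴴ * L.Hs H j c.1) r c.2

/-- The feedback `F_j(H_j)`: the null spaces of `(S_j^r)† H_{jp}^s`, `p ∈ Ω_j^III`, and the span
of the columns of the transpose of `[⋯ (S_j^r)† H_{jq}^s ⋯]_{q ∈ Ω_j^IV}`.  (It does not depend on
which orthonormal basis `S_j^r` is used.) -/
def feedback (H : Channel M N) (Sr : L.RxFrames) (j : Fin K) : L.Feedback j :=
  (fun p => nullSpace ((Sr j)ᴴ * L.Hs H j p), colSpan (L.concatIV H Sr j)ᵀ)

/-! ### The matrices `G_{ji}` and `X_{ji}` -/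

/-- Families of `M_j^e × N_i^e` matrices `G_{ji}`. -/
abbrev GFamily : Type := ∀ j i : Fin K, Matrix (Fin (L.me j)) (Fin (L.ne i)) ℂ

/-- `G_{ji} = R_j (S_j^r)† H_{ji}^s S_i^t`. -/
def G (H : Channel M N) (Sr : L.RxFrames) (St : L.TxFrames)
    (R : ∀ j : Fin K, Matrix (Fin (L.me j)) (Fin (L.me j)) ℂ) : L.GFamily :=
  fun j i => R j * (Sr j)ᴴ * L.Hs H j i * St i

/-- The positions of the unknowns `vec(Ũ_1†), …, vec(Ũ_K†), vec(Ṽ_1), …, vec(Ṽ_K)`, where `Ũ_p†`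
has size `d_p^0 × (M_p^e - d_p^0)`, `Ṽ_q` has size `(N_q^e - d_q) × d_q`, and an entry of `vec`
is addressed by (column, row). -/
abbrev Unknowns : Type :=
  (Σ p : Fin K, Fin (L.me p - L.d0 d p) × Fin (L.d0 d p)) ⊕
    (Σ q : Fin K, Fin (d q) × Fin (L.ne q - d q))

theorem le_me {L : Profile M N} {a : ℕ} {j : Fin K} (h : (a : ℤ) ≤ L.Me j) : a ≤ L.me j := by
  unfold me; omega

theorem le_ne {L : Profile M N} {a : ℕ} {i : Fin K} (h : (a : ℤ) ≤ L.Ne i) : a ≤ L.ne i := by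
  unfold ne; omega

/-- The lower left block `G_{ji}^{(2)}`, of size `(M_j^e - d_j^0) × d_i`. -/
def G2 {L : Profile M N} {d : Fin K → ℕ} (hM : ∀ j, (L.d0 d j : ℤ) ≤ L.Me j)
    (hN : ∀ i, (d i : ℤ) ≤ L.Ne i) (G : L.GFamily) (j i : Fin K) :
    Matrix (Fin (L.me j - L.d0 d j)) (Fin (d i)) ℂ :=
  (G j i).submatrix (lastIdx (le_me (hM j))) (firstIdx (le_ne (hN i)))

/-- The upper right block `G_{ji}^{(3)}`, of size `d_j^0 × (N_i^e - d_i)`. -/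
def G3 {L : Profile M N} {d : Fin K → ℕ} (hM : ∀ j, (L.d0 d j : ℤ) ≤ L.Me j)
    (hN : ∀ i, (d i : ℤ) ≤ L.Ne i) (G : L.GFamily) (j i : Fin K) :
    Matrix (Fin (L.d0 d j)) (Fin (L.ne i - d i)) ℂ :=
  (G j i).submatrix (firstIdx (le_me (hM j))) (lastIdx (le_ne (hN i)))

/-- `X_{ji} = [0, (G_{ji}^{(2)})ᵀ ⊗ I_{d_j^0}, 0, I_{d_i} ⊗ G_{ji}^{(3)}, 0]`: the first nonzero
block sits at the unknowns `vec(Ũ_j†)`, the second one at the unknowns `vec(Ṽ_i)`. -/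
def X {L : Profile M N} {d : Fin K → ℕ} (hM : ∀ j, (L.d0 d j : ℤ) ≤ L.Me j)
    (hN : ∀ i, (d i : ℤ) ≤ L.Ne i) (G : L.GFamily) (j i : Fin K) :
    Matrix (Fin (d i) × Fin (L.d0 d j)) (L.Unknowns d) ℂ :=
  Matrix.of fun r c =>
    match c with
    | Sum.inl ⟨p, x⟩ =>
        if h : p = j then
          ((G2 hM hN G j i)ᵀ ⊗ₖ (1 : Matrix (Fin (L.d0 d j)) (Fin (L.d0 d j)) ℂ)) r (h ▸ x)
        else 0
    | Sum.inr ⟨q, y⟩ =>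
        if h : q = i then
          ((1 : Matrix (Fin (d i)) (Fin (d i)) ℂ) ⊗ₖ G3 hM hN G j i) r (h ▸ y)
        else 0

/-- The rows of all the matrices `X_{ji}`, `i ∈ Ω_j^IV`, taken together, are linearly
independent. -/
def RowsIndependent {L : Profile M N} {d : Fin K → ℕ} (hM : ∀ j, (L.d0 d j : ℤ) ≤ L.Me j)
    (hN : ∀ i, (d i : ℤ) ≤ L.Ne i) (G : L.GFamily) : Prop :=
  LinearIndependent ℂ
    (fun r : (Σ e : (Σ j : Fin K, {i // i ∈ L.ΩIV j}), Fin (d e.2) × Fin (L.d0 d e.1)) =>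
      X hM hN G r.1.1 r.1.2 r.2)

/-- At the realization `H`, the rows of the `X_{ji}` are linearly independent (for some `S_j^r`,
`S_i^t` belonging to `H` and some invertible `R_j`). -/
def IndependentAt {L : Profile M N} {d : Fin K → ℕ} (hM : ∀ j, (L.d0 d j : ℤ) ≤ L.Me j)
    (hN : ∀ i, (d i : ℤ) ≤ L.Ne i) (H : Channel M N) : Prop :=
  ∃ Sr St R, L.IsFrames H Sr St ∧ (∀ j, IsUnit (R j)) ∧ RowsIndependent hM hN (L.G H Sr St R)

/-- A rule that computes `S_j^r`, `S_i^t` from the channel: it is measurable, it uses only the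
links under strategies II and III (those through which these matrices are defined), and its
values are correct for almost every realization. -/
structure FrameRule where
  Sr : Channel M N → L.RxFrames
  St : Channel M N → L.TxFrames
  measurable_Sr : ∀ j a b, Measurable fun H => Sr H j a b
  measurable_St : ∀ i a b, Measurable fun H => St H i a b
  local_dep : ∀ H H' : Channel M N, (∀ j, ∀ i ∈ L.ΩII j ∪ L.ΩIII j, H j i = H' j i) →
    Sr H = Sr H' ∧ St H = St H'
  isFrames : ∀ᵐ H ∂channelLaw M N, L.IsFrames H (Sr H) (St H)

/-! ### The interference alignment problem with partial CSI feedback -/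

/-- Precoding rules: the precoders `V_i` as functions of the feedback of all receivers. -/
abbrev PrecodingRule : Type :=
  (∀ j, L.Feedback j) → ∀ i : Fin K, Matrix (Fin (N i)) (Fin (d i)) ℂ

end Profile

/-- Decorrelation rules: `U_j` as a function of the local receive CSI `(H_{ji} V_i)_i`. -/
abbrev DecorrelationRule {K : ℕ} (M d : Fin K → ℕ) : Type :=
  ∀ j : Fin K, (∀ i : Fin K, Matrix (Fin (M j)) (Fin (d i)) ℂ) →
    Matrix (Fin (M j)) (Fin (d j)) ℂ

/-- The interference alignment conditions: `rank (U_j† H_{jj} V_j) = d_j` for all `j` and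
`U_j† H_{ji} V_i = 0` for all `i ≠ j`. -/
def Aligns {K : ℕ} {M N d : Fin K → ℕ} (H : Channel M N)
    (V : ∀ i : Fin K, Matrix (Fin (N i)) (Fin (d i)) ℂ)
    (U : ∀ j : Fin K, Matrix (Fin (M j)) (Fin (d j)) ℂ) : Prop :=
  (∀ j, ((U j)ᴴ * Matrix.of (H j j) * V j).rank = d j) ∧
    ∀ i j, i ≠ j → (U j)ᴴ * Matrix.of (H j i) * V i = 0

namespace Profile

variable {K : ℕ} {M N : Fin K → ℕ} (L : Profile M N) {d : Fin K → ℕ}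

/-- At the realization `H`, the rules `P`, `D` solve the interference alignment problem under the
feedback profile `L`, within the prescribed transceiver structure. -/
def SolvesAt (P : L.PrecodingRule d) (D : DecorrelationRule M d) (H : Channel M N) : Prop :=
  (∃ Sr St, L.IsFrames H Sr St) ∧
  ∀ Sr St, L.IsFrames H Sr St →
    -- the alignment conditions hold for the precoders and decorrelators given by the rules
    Aligns H (P (L.feedback H Sr))
      (fun j => D j fun i => Matrix.of (H j i) * P (L.feedback H Sr) i) ∧
    -- the precoders are `V_i = [S_i^t V_i^a; 0]`
    (∃ Va : ∀ i, Matrix (Fin (L.ne i)) (Fin (d i)) ℂ,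
      ∀ i, P (L.feedback H Sr) i = padRows (N i) (St i * Va i)) ∧
    -- with them, also decorrelators `U_j = [S_j^r R_j† U_j^a; 0]` do, for all invertible `R_j`
    ∀ R : ∀ j, Matrix (Fin (L.me j)) (Fin (L.me j)) ℂ, (∀ j, IsUnit (R j)) →
      ∃ Ua : ∀ j, Matrix (Fin (L.me j)) (Fin (d j)) ℂ,
        Aligns H (P (L.feedback H Sr)) fun j => padRows (M j) (Sr j * (R j)ᴴ * Ua j)

end Profile

end IA

end

/-!
The theorem rests on two facts: independence at one family of matrices `G_{ji}` makes the alignment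
equations of the strategy IV links solvable for *every* family, and the links that the feedback does
not reveal are random enough to separate the streams that remain.

**Alignment.**  Look for filters with `U_j† = [I, Ũ_j†]` and precoders `V_i = [I; Ṽ_i]`.  The
equations for the strategy IV links read `G⁽¹⁾ + Ũ† G⁽²⁾ + G⁽³⁾ Ṽ + Ũ† G⁽⁴⁾ Ṽ = 0`, and the matrix of
their linear part is made of the `X_{ji}`.  When its rows are independent, restricting the unknowns
to a subspace makes the linear part invertible, so that the constant terms `G⁽¹⁾` that can be reached
include the range of a polynomial map between spaces of the same dimension, and this range contains
an open set (`interior_range_nonempty`).  Such a map has dense range (`denseRange_of_interior_range`).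
Solutions can be orthonormalized, and orthonormal matrices form a compact set, so that the solvable
families are closed; hence all `G⁽¹⁾` are solvable (`alignableIV_of_det_ne_zero`).  As independence
holds on a dense set of families if it holds for one, the strategy IV links can be aligned for all
families (`alignableIV_of_rowsIndependent`).

**Precoders from the feedback.**  Whether given orthonormal precoders cancel the links of strategies
II, III and IV, together with suitable filters, is determined by the feedback
(`isPrecoder_iff_feedback`).  The set of such precoders is compact and never empty, and taking its
lexicographically smallest element is a rule that uses the feedback only and is measurable in the
channel (`exists_measurable_selection`).

**Separation of the streams.**  This rule does not look at the direct and the strategy I links.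
After the other links are cancelled, receiver `j` sees its own and the strategy I streams through a
square matrix that is linear in these links and equal to the identity for a suitable value of them
(`exists_streamMatrix_mix_eq_one`).  Resampling these links (`ae_exists_of_mix`) shows that almost
surely the filters can be chosen such that it is invertible, and inverting it gives the decorrelator
(`CancelsAt.exists_decorrelator`).  Measurability of the precoders is what allows Fubini's theorem
here.

**Genericity.**  A holomorphic function of the channel that is not identically zero is almost surely
nonzero (`holoGeneric_channelLaw`).  Applied in turn to the links of strategies II and III, with the
frames depending on the former, this yields the almost sure existence of the frames
(`ae_exists_isFrames`); applied to the links of strategy IV, which take `G_{ji}` to arbitrary values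
for given frames, it yields independence almost surely (`ae_independentAt`,
`FrameRule.ae_rowsIndependent`) unless no family `G` has independent rows, in which case
independence fails everywhere.
-/

namespace IA

/-! ### Product measures and zero sets of holomorphic functions -/

/-- Merging two independent families coordinate by coordinate, by maps that merge the coordinate
laws, produces the product law. -/
theorem measurePreserving_pi_combine {ι : Type*} [Fintype ι] {X Y Z : ι → Type*}
    [∀ i, MeasurableSpace (X i)] [∀ i, MeasurableSpace (Y i)] [∀ i, MeasurableSpace (Z i)]
    (μ : ∀ i, Measure (X i)) (ν : ∀ i, Measure (Y i)) (ρ : ∀ i, Measure (Z i))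
    [∀ i, IsProbabilityMeasure (μ i)] [∀ i, IsProbabilityMeasure (ν i)]
    [∀ i, IsProbabilityMeasure (ρ i)] (m : ∀ i, X i × Y i → Z i)
    (hm : ∀ i, MeasurePreserving (m i) ((μ i).prod (ν i)) (ρ i)) :
    MeasurePreserving (fun p : (∀ i, X i) × (∀ i, Y i) => fun i => m i (p.1 i, p.2 i))
      ((Measure.pi μ).prod (Measure.pi ν)) (Measure.pi ρ) := by
  have hsplit : MeasurePreserving
      (fun z : ∀ i, X i × Y i => ((fun i => (z i).1, fun i => (z i).2) : (∀ i, X i) × (∀ i, Y i)))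
      (Measure.pi fun i => (μ i).prod (ν i)) ((Measure.pi μ).prod (Measure.pi ν)) := by
    refine ⟨by fun_prop, ?_⟩
    refine (Measure.FiniteSpanningSetsIn.ext ?_ (isPiSystem_pi.prod isPiSystem_pi)
      ((Measure.FiniteSpanningSetsIn.pi fun i => (μ i).toFiniteSpanningSetsIn).prod
      (Measure.FiniteSpanningSetsIn.pi fun i => (ν i).toFiniteSpanningSetsIn)) ?_).symm
    · refine (generateFrom_eq_prod generateFrom_pi generateFrom_pi ?_ ?_).symm
      · exact (Measure.FiniteSpanningSetsIn.pi
          fun i => (μ i).toFiniteSpanningSetsIn).isCountablySpanning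
      · exact (Measure.FiniteSpanningSetsIn.pi
          fun i => (ν i).toFiniteSpanningSetsIn).isCountablySpanning
    · rintro _ ⟨s, ⟨s, hs, rfl⟩, ⟨_, ⟨t, ht, rfl⟩, rfl⟩⟩
      rw [Measure.map_apply (by fun_prop)
        ((MeasurableSet.univ_pi fun i => hs i trivial).prod
          (MeasurableSet.univ_pi fun i => ht i trivial))]
      rw [show (fun z : ∀ i, X i × Y i =>
          ((fun i => (z i).1, fun i => (z i).2) : (∀ i, X i) × (∀ i, Y i))) ⁻¹'
            (Set.univ.pi s ×ˢ Set.univ.pi t) = Set.univ.pi fun i => s i ×ˢ t i by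
          ext; simp [Set.mem_pi, forall_and]]
      simp_rw [Measure.pi_pi, Measure.prod_prod, Measure.pi_pi, Finset.prod_mul_distrib]
  have hall := measurePreserving_pi (fun i => (μ i).prod (ν i)) ρ hm
  have hmeas : Measurable
      (fun p : (∀ i, X i) × (∀ i, Y i) => fun i => m i (p.1 i, p.2 i)) := by
    refine measurable_pi_iff.2 fun i => (hm i).measurable.comp ?_
    fun_prop
  refine ⟨hmeas, ?_⟩
  rw [← hsplit.map_eq, Measure.map_map hmeas hsplit.measurable]
  exact hall.map_eq

/-- If a point of law `ρ` is obtained by merging two independent points, then a measurable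
event may be checked for almost every second point, with the first one fixed. -/
theorem ae_mem_of_ae_ae {α β γ : Type*} [MeasurableSpace α] [MeasurableSpace β]
    [MeasurableSpace γ] {μ : Measure α} {ν : Measure β} {ρ : Measure γ} [SFinite ν]
    {m : α × β → γ} (hm : MeasurePreserving m (μ.prod ν) ρ) {E : Set γ} (hE : MeasurableSet E)
    (h : ∀ᵐ x ∂μ, ∀ᵐ y ∂ν, m (x, y) ∈ E) : ∀ᵐ z ∂ρ, z ∈ E := by
  rw [← hm.map_eq]
  exact (ae_map_iff hm.measurable.aemeasurable (p := (· ∈ E)) hE).2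
    ((Measure.ae_prod_mem_iff_ae_ae_mem (hm.measurable hE)).2 h)

/-- The measure `μ` does not charge the zero set of any holomorphic function other than the
zero function. -/
def HoloGeneric {E : Type*} [NormedAddCommGroup E] [NormedSpace ℂ E] [MeasurableSpace E]
    (μ : Measure E) : Prop :=
  ∀ f : E → ℂ, Differentiable ℂ f → (∃ x, f x ≠ 0) → ∀ᵐ x ∂μ, f x ≠ 0

theorem HoloGeneric.of_nullSingletonClass (μ : Measure ℂ) [NullSingletonClass μ] :
    HoloGeneric μ := by
  rintro f hf ⟨x, hx⟩
  have h := AnalyticOnNhd.preimage_zero_mem_codiscrete (fun z _ => hf.analyticAt z) hx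
  have h2 := ae_restrict_le_codiscreteWithin (μ := μ) MeasurableSet.univ h
  rw [Measure.restrict_univ] at h2
  exact h2

/-- Finite products of measures that are generic for holomorphic functions are again so:
the coordinates are moved one by one from a point where `f ≠ 0` to a random point. -/
theorem HoloGeneric.pi {ι : Type*} [Fintype ι] {E : ι → Type*}
    [∀ i, NormedAddCommGroup (E i)] [∀ i, NormedSpace ℂ (E i)] [∀ i, MeasurableSpace (E i)]
    [∀ i, BorelSpace (E i)] [∀ i, SecondCountableTopology (E i)]
    {μ : ∀ i, Measure (E i)} [∀ i, IsProbabilityMeasure (μ i)] (h : ∀ i, HoloGeneric (μ i)) :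
    HoloGeneric (Measure.pi μ) := by
  classical
  rintro f hf ⟨x₀, hx₀⟩
  have key : ∀ s : Finset ι, ∀ᵐ x ∂Measure.pi μ, f (fun i => if i ∈ s then x i else x₀ i) ≠ 0 := by
    intro s
    induction s using Finset.induction_on with
    | empty => simpa using hx₀
    | insert a s ha ih =>
      have hmp := measurePreserving_pi_combine μ μ μ
        (fun i p => if i = a then p.2 else p.1) (fun i => by
          by_cases hi : i = a
          · simpa [hi] using measurePreserving_snd
          · simpa [hi] using measurePreserving_fst)
      refine ae_mem_of_ae_ae hmp
        (E := {x | f (fun i => if i ∈ insert a s then x i else x₀ i) ≠ 0}) ?_ ?_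
      · refine (isOpen_ne.preimage ?_).measurableSet
        refine hf.continuous.comp (continuous_pi fun i => ?_)
        split_ifs <;> fun_prop
      filter_upwards [ih] with x hx
      have h1 := h a (fun t => f (Function.update (fun i => if i ∈ s then x i else x₀ i) a t))
        (by
          refine hf.comp ?_
          refine differentiable_pi.2 fun i => ?_
          by_cases hi : i = a
          · subst hi; simp
          · simp [Function.update_of_ne hi])
        ⟨x₀ a, by
          rwa [Function.update_eq_self_iff.2 (by simp [ha])]⟩
      have h2 := (Measure.quasiMeasurePreserving_eval μ a).ae h1
      filter_upwards [h2] with y hy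
      convert hy using 2
      funext i
      by_cases hi : i = a
      · subst hi; simp
      · simp [hi]
  simpa using key Finset.univ

instance : IsProbabilityMeasure stdComplexGaussian := by
  unfold stdComplexGaussian
  exact Measure.isProbabilityMeasure_map (by fun_prop)

instance : NullSingletonClass stdComplexGaussian := by
  refine ⟨fun z => ?_⟩
  have : NullSingletonClass (gaussianReal 0 (1 / 2)) :=
    nullSingletonClass_gaussianReal (by norm_num)
  unfold stdComplexGaussian
  rw [Measure.map_apply (by fun_prop) (measurableSet_singleton z)]
  refine measure_mono_null (t := {(z.re, z.im)}) ?_ (measure_singleton _)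
  rintro ⟨a, b⟩ h
  have h' : (a : ℂ) + (b : ℂ) * Complex.I = z := h
  simp [← h']

instance {K : ℕ} (M N : Fin K → ℕ) : IsProbabilityMeasure (channelLaw M N) := by
  unfold channelLaw; infer_instance

theorem holoGeneric_channelLaw {K : ℕ} (M N : Fin K → ℕ) : HoloGeneric (channelLaw M N) :=
  .pi fun _ => .pi fun _ => .pi fun _ => .pi fun _ => .of_nullSingletonClass _

/-- The channel whose links `(j, i)` with `i ∈ A j` are those of `H` and whose other links are
those of `H'`. -/
def mix {K : ℕ} {M N : Fin K → ℕ} (A : Fin K → Finset (Fin K)) (H H' : Channel M N) :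
    Channel M N :=
  fun j i => if i ∈ A j then H j i else H' j i

/-- Resampling the links outside `A` independently does not change the law of the channel. -/
theorem measurePreserving_mix {K : ℕ} {M N : Fin K → ℕ} (A : Fin K → Finset (Fin K)) :
    MeasurePreserving (fun p : Channel M N × Channel M N => mix A p.1 p.2)
      ((channelLaw M N).prod (channelLaw M N)) (channelLaw M N) :=
  measurePreserving_pi_combine _ _ _
    (fun j (p : (∀ i, Fin (M j) → Fin (N i) → ℂ) × (∀ i, Fin (M j) → Fin (N i) → ℂ)) i =>
      if i ∈ A j then p.1 i else p.2 i)
    fun j => measurePreserving_pi_combine _ _ _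
      (fun i (p : (Fin (M j) → Fin (N i) → ℂ) × (Fin (M j) → Fin (N i) → ℂ)) =>
        if i ∈ A j then p.1 else p.2) fun i => by
          by_cases hi : i ∈ A j
          · simpa [hi] using measurePreserving_fst
          · simpa [hi] using measurePreserving_snd

/-! ### Measurable selection from compact sets -/

theorem isClosed_exists_mem_compact {X Y : Type*} [TopologicalSpace X] [TopologicalSpace Y]
    {Q : Set Y} (hQ : IsCompact Q) {C : Set (X × Y)} (hC : IsClosed C) :
    IsClosed {x | ∃ y ∈ Q, (x, y) ∈ C} := by
  have : CompactSpace Q := isCompact_iff_compactSpace.1 hQ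
  have h := isClosedMap_fst_of_compactSpace (X := X) (Y := Q)
    ((fun p : X × Q => (p.1, (p.2 : Y))) ⁻¹' C) (hC.preimage (by fun_prop))
  convert h using 1
  ext x
  constructor
  · rintro ⟨y, hy, h⟩
    exact ⟨(x, ⟨y, hy⟩), h, rfl⟩
  · rintro ⟨⟨x', ⟨y, hy⟩⟩, h, rfl⟩
    exact ⟨y, hy, h⟩

/-- The lexicographically smallest point of the sections of a closed set with sections in a fixed
compact set is a measurable function of the base point; it depends only on the section. -/
theorem exists_measurable_selection_fin (m : ℕ) {X : Type*} [TopologicalSpace X]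
    [SecondCountableTopology X] [MeasurableSpace X] [BorelSpace X]
    {Q : Set (Fin m → ℝ)} (hQ : IsCompact Q) {C : Set (X × (Fin m → ℝ))} (hC : IsClosed C)
    (hCQ : ∀ x y, (x, y) ∈ C → y ∈ Q) :
    ∃ s : X → Fin m → ℝ, Measurable s ∧ (∀ x, (∃ y, (x, y) ∈ C) → (x, s x) ∈ C) ∧
      ∀ x x', (∀ y, (x, y) ∈ C ↔ (x', y) ∈ C) → s x = s x' := by
  induction m generalizing X with
  | zero =>
    refine ⟨fun _ => 0, measurable_const, ?_, fun _ _ _ => rfl⟩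
    rintro x ⟨y, hy⟩
    rwa [Subsingleton.elim 0 y]
  | succ m ih =>
    -- the smallest first coordinate; the remaining coordinates are chosen by induction, with the
    -- value of the first one as an additional parameter
    let a : X → ℝ := fun x => sInf {t | ∃ y, (x, y) ∈ C ∧ y 0 = t}
    have hcpt : ∀ x, IsCompact {t | ∃ y, (x, y) ∈ C ∧ y 0 = t} := by
      intro x
      have h1 : IsCompact {y | (x, y) ∈ C} :=
        hQ.of_isClosed_subset (hC.preimage (by fun_prop)) fun y hy => hCQ x y hy
      exact h1.image (f := fun y : Fin (m + 1) → ℝ => y 0) (by fun_prop)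
    have hclosed : ∀ D : Set (X × (Fin (m + 1) → ℝ)), IsClosed D →
        MeasurableSet {x | ∃ y, (x, y) ∈ C ∧ (x, y) ∈ D} := by
      intro D hD
      have := (isClosed_exists_mem_compact hQ (hC.inter hD)).measurableSet
      convert this using 1
      ext x
      exact ⟨fun ⟨y, h1, h2⟩ => ⟨y, hCQ x y h1, h1, h2⟩, fun ⟨y, _, h1, h2⟩ => ⟨y, h1, h2⟩⟩
    have ha : Measurable a := by
      refine measurable_of_Iic fun c => ?_
      have h1 := hclosed {p | p.2 0 ≤ c} (isClosed_le (by fun_prop) (by fun_prop))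
      have h2 := hclosed Set.univ isClosed_univ
      -- the infimum of the empty set of reals is `0`
      have : a ⁻¹' Set.Iic c =
          {x | ∃ y, (x, y) ∈ C ∧ (x, y) ∈ {p : X × (Fin (m+1) → ℝ) | p.2 0 ≤ c}}
          ∪ ({x | ∃ y, (x, y) ∈ C ∧ (x, y) ∈ Set.univ}ᶜ ∩ {_x | 0 ≤ c}) := by
        ext x
        by_cases hx : ∃ y, (x, y) ∈ C
        · have hne : {t | ∃ y, (x, y) ∈ C ∧ y 0 = t}.Nonempty := by
            obtain ⟨y, hy⟩ := hx; exact ⟨_, y, hy, rfl⟩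
          simp only [Set.mem_preimage, Set.mem_Iic, Set.mem_union, Set.mem_ofPred_eq,
            Set.mem_univ, and_true, Set.mem_inter_iff, Set.mem_compl_iff, hx, not_true,
            false_and, or_false, a]
          constructor
          · intro h
            obtain ⟨y, hy, hy0⟩ := (hcpt x).sInf_mem hne
            exact ⟨y, hy, hy0.trans_le h⟩
          · rintro ⟨y, hy, hyc⟩
            exact (csInf_le (hcpt x).bddBelow ⟨y, hy, rfl⟩).trans hyc
        · have hempty : {t | ∃ y, (x, y) ∈ C ∧ y 0 = t} = ∅ := by
            ext t; simp only [Set.mem_ofPred_eq, Set.mem_empty_iff_false, iff_false]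
            rintro ⟨y, hy, _⟩; exact hx ⟨y, hy⟩
          have h0 : a x = 0 := by simp only [a, hempty, Real.sInf_empty]
          push Not at hx
          simp [h0, hx]
      rw [this]
      exact h1.union (h2.compl.inter (.const _))
    let tl : (Fin (m + 1) → ℝ) → (Fin m → ℝ) := fun y i => y i.succ
    obtain ⟨s, hs, hsC, hsx⟩ := ih (X := X × ℝ)
      (Q := tl '' Q) (hQ.image (by fun_prop))
      (C := {p | (p.1.1, (Fin.cons p.1.2 p.2 : Fin (m + 1) → ℝ)) ∈ C})
      (hC.preimage (by
        refine Continuous.prodMk (by fun_prop) (continuous_pi fun i => ?_)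
        refine Fin.cases ?_ (fun i => ?_) i
        · simp only [Fin.cons_zero]; fun_prop
        · simp only [Fin.cons_succ]; fun_prop))
      (fun x y hy => ⟨_, hCQ _ _ hy, by ext i; simp [tl]⟩)
    refine ⟨fun x => Fin.cons (a x) (s (x, a x)), ?_, ?_, ?_⟩
    · refine measurable_pi_iff.2 fun i => ?_
      refine Fin.cases ?_ (fun i => ?_) i
      · simpa using ha
      · simp only [Fin.cons_succ]
        exact (measurable_pi_apply i).comp (hs.comp (measurable_id.prodMk ha))
    · rintro x ⟨y, hy⟩
      refine hsC (x, a x) ?_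
      obtain ⟨z, hz, hz0⟩ := (hcpt x).sInf_mem ⟨_, y, hy, rfl⟩
      refine ⟨tl z, ?_⟩
      have : (Fin.cons (a x) (tl z) : Fin (m + 1) → ℝ) = z := by
        ext i
        refine Fin.cases ?_ (fun i => ?_) i
        · simpa [a] using hz0.symm
        · simp [tl]
      simpa [this] using hz
    · intro x x' h
      have hax : a x = a x' := by simp only [a, h]
      have : s (x, a x) = s (x', a x') := hsx _ _ fun y => by
        simp only [Set.mem_ofPred_eq, hax, h]
      simp only [hax] at this ⊢
      rw [this]

/-- A measurable selection from the sections of a closed set with sections in a fixed compact set.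
The selected point is a function of the section alone. -/
theorem exists_measurable_selection {E : Type*} [NormedAddCommGroup E] [NormedSpace ℝ E]
    [FiniteDimensional ℝ E] [MeasurableSpace E] [BorelSpace E]
    {X : Type*} [TopologicalSpace X]
    [SecondCountableTopology X] [MeasurableSpace X] [BorelSpace X]
    {Q : Set E} (hQ : IsCompact Q) {C : Set (X × E)} (hC : IsClosed C)
    (hCQ : ∀ x y, (x, y) ∈ C → y ∈ Q) :
    ∃ s : X → E, Measurable s ∧ (∀ x, (∃ y, (x, y) ∈ C) → (x, s x) ∈ C) ∧
      ∀ x x', (∀ y, (x, y) ∈ C ↔ (x', y) ∈ C) → s x = s x' := by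
  let e : E ≃L[ℝ] (Fin (Module.finrank ℝ E) → ℝ) :=
    ContinuousLinearEquiv.ofFinrankEq (by simp)
  obtain ⟨s, hs, hsC, hsx⟩ := exists_measurable_selection_fin (Module.finrank ℝ E) (X := X)
    (hQ.image e.continuous) (C := {p | (p.1, e.symm p.2) ∈ C})
    (hC.preimage (by fun_prop))
    (fun x y hy => ⟨e.symm y, hCQ _ _ hy, by simp⟩)
  refine ⟨fun x => e.symm (s x), e.symm.continuous.measurable.comp hs, ?_, ?_⟩
  · rintro x ⟨y, hy⟩
    exact hsC x ⟨e y, by simpa using hy⟩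
  · intro x x' h
    simp only [hsx x x' fun y => h (e.symm y)]

/-- The open condition `g ≠ 0` is a countable union of closed conditions, so that solvability with
`g ≠ 0` in a compact set is measurable although it need not be closed. -/
theorem measurableSet_exists_mem_compact_ne {X Y : Type*} [TopologicalSpace X]
    [MeasurableSpace X] [BorelSpace X] [TopologicalSpace Y]
    {Q : Set Y} (hQ : IsCompact Q) {C : Set (X × Y)} (hC : IsClosed C) {g : X × Y → ℂ}
    (hg : Continuous g) : MeasurableSet {x | ∃ y ∈ Q, (x, y) ∈ C ∧ g (x, y) ≠ 0} := by
  have : {x | ∃ y ∈ Q, (x, y) ∈ C ∧ g (x, y) ≠ 0} =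
      ⋃ n : ℕ, {x | ∃ y ∈ Q, (x, y) ∈ C ∩ {p | 1 / ((n : ℝ) + 1) ≤ ‖g p‖}} := by
    ext x
    simp only [Set.mem_ofPred_eq, Set.mem_iUnion, Set.mem_inter_iff]
    constructor
    · rintro ⟨y, hy, hyC, hgy⟩
      obtain ⟨n, hn⟩ := exists_nat_one_div_lt (norm_pos_iff.2 hgy)
      exact ⟨n, y, hy, hyC, hn.le⟩
    · rintro ⟨n, y, hy, hyC, hn⟩
      refine ⟨y, hy, hyC, fun h0 => ?_⟩
      rw [h0, norm_zero] at hn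
      exact absurd hn (not_le.2 (by positivity))
  rw [this]
  exact .iUnion fun n => (isClosed_exists_mem_compact hQ
    (hC.inter (isClosed_le (by fun_prop) (by fun_prop)))).measurableSet

/-- Suppose that a condition `(H, s H, y) ∈ C` involves only the links in `A`, and can be met for
almost every `H`.  If, in addition, `g (·, s H, y)` does not vanish identically in the links outside
`A`, then almost surely the condition can be met with `g (H, s H, y) ≠ 0`. -/
theorem ae_exists_of_mix {K : ℕ} {M N : Fin K → ℕ} (A : Fin K → Finset (Fin K))
    {T Y : Type*} [TopologicalSpace T] [SecondCountableTopology T] [MeasurableSpace T]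
    [BorelSpace T] [TopologicalSpace Y] {s : Channel M N → T} (hs : Measurable s)
    (hsA : ∀ᵐ H ∂channelLaw M N, ∀ H', s (mix A H H') = s H)
    {Q : Set Y} (hQ : IsCompact Q) {C : Set ((Channel M N × T) × Y)} (hC : IsClosed C)
    {g : (Channel M N × T) × Y → ℂ} (hg : Continuous g)
    (hgd : ∀ t y, Differentiable ℂ fun H => g ((H, t), y))
    (h : ∀ᵐ H ∂channelLaw M N, ∃ y ∈ Q, (∀ H', ((mix A H H', s H), y) ∈ C) ∧
      ∃ H', g ((mix A H H', s H), y) ≠ 0) :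
    ∀ᵐ H ∂channelLaw M N, ∃ y ∈ Q, ((H, s H), y) ∈ C ∧ g ((H, s H), y) ≠ 0 := by
  refine ae_mem_of_ae_ae (measurePreserving_mix A)
    (E := {H | ∃ y ∈ Q, ((H, s H), y) ∈ C ∧ g ((H, s H), y) ≠ 0}) ?_ ?_
  · exact (measurable_id.prodMk hs) (measurableSet_exists_mem_compact_ne hQ hC hg)
  filter_upwards [h, hsA] with H ⟨y, hyQ, hyC, hy⟩ hsH
  have h1 := holoGeneric_channelLaw M N (fun H' => g ((mix A H H', s H), y))
    ((hgd (s H) y).comp (by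
      refine differentiable_pi.2 fun j => differentiable_pi.2 fun i => ?_
      unfold mix
      split_ifs <;> fun_prop)) hy
  filter_upwards [h1] with H' hH'
  refine ⟨y, hyQ, ?_⟩
  rw [hsH]
  exact ⟨hyC H', hH'⟩

/-! ### Dominant polynomial maps -/

/-- The zeros of a nonzero holomorphic function have empty interior: on the complex line to a point
where `f ≠ 0` they are isolated. -/
theorem dense_ne_zero_of_differentiable {E : Type*} [NormedAddCommGroup E] [NormedSpace ℂ E]
    {f : E → ℂ} (hf : Differentiable ℂ f) {x₀ : E} (h₀ : f x₀ ≠ 0) : Dense {x | f x ≠ 0} := by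
  intro x
  let l : ℂ → E := fun t => x + t • (x₀ - x)
  have hl : Differentiable ℂ l := by fun_prop
  have hfl : Differentiable ℂ (f ∘ l) := hf.comp hl
  have hev : ∀ᶠ t in nhdsWithin (0 : ℂ) {0}ᶜ, (f ∘ l) t ≠ 0 := by
    by_contra hcon
    have h := AnalyticOnNhd.eqOn_zero_of_preconnected_of_frequently_eq_zero (f := f ∘ l)
      (z₀ := 0) (U := Set.univ) (fun z _ => hfl.analyticAt z) isPreconnected_univ trivial
      (by simpa [Filter.not_eventually] using hcon)
    exact h₀ (by simpa [l] using h (Set.mem_univ (1 : ℂ)))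
  have ht : Filter.Tendsto l (nhdsWithin (0 : ℂ) {0}ᶜ) (nhds x) := by
    have h : Filter.Tendsto l (nhds 0) (nhds (l 0)) := hl.continuous.tendsto 0
    rw [show l 0 = x by simp [l]] at h
    exact h.mono_left nhdsWithin_le_nhds
  exact mem_closure_of_tendsto ht hev

open MvPolynomial in
/-- If the range of a polynomial map contains an open set, then its components are algebraically
independent. -/
theorem algebraicIndependent_of_interior_range {ι : Type*} [Fintype ι]
    (g : ι → MvPolynomial ι ℂ)
    (h : (interior (Set.range fun (x : ι → ℂ) i => eval x (g i))).Nonempty) :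
    AlgebraicIndependent ℂ g := by
  rw [algebraicIndependent_iff]
  intro P hP
  obtain ⟨y, hy⟩ := h
  obtain ⟨ε, hε, hball⟩ := Metric.isOpen_iff.1 isOpen_interior y hy
  refine funext_set (fun i => Metric.ball (y i) ε) (fun i => ?_) fun z hz => ?_
  · exact infinite_of_mem_nhds (y i) (Metric.ball_mem_nhds _ hε)
  have hz' : z ∈ Metric.ball y ε := by
    rw [ball_pi _ hε]; exact hz
  obtain ⟨x, rfl⟩ := interior_subset (hball hz')
  have : ∀ P, eval x (aeval g P) = eval (fun i => eval x (g i)) P := by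
    intro P
    induction P using MvPolynomial.induction_on with
    | C c => simp
    | add a b ha hb => simp_all
    | mul_X a i ha => simp_all
  rw [← this, hP]; simp

open MvPolynomial in
/-- A polynomial self-map of affine space with algebraically independent components hits every point
at which a certain nonzero polynomial does not vanish.  All coordinates are algebraic
over the components of the map; where the leading coefficients of their equations do not vanish, a
valuation ring lying over the point contains the coordinates, so that the fibre is not
empty by the Nullstellensatz. -/
theorem exists_ne_zero_of_algebraicIndependent {ι : Type*} [Fintype ι]
    (g : ι → MvPolynomial ι ℂ) (hg : AlgebraicIndependent ℂ g) :
    ∃ α : MvPolynomial ι ℂ, α ≠ 0 ∧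
      ∀ y : ι → ℂ, eval y α ≠ 0 → ∃ x : ι → ℂ, (fun i => eval x (g i)) = y := by
  have htb : IsTranscendenceBasis ℂ g := by
    refine hg.isTranscendenceBasis_of_lift_trdeg_le_of_finite ?_
    rw [MvPolynomial.trdeg_of_isDomain]
    simp
  have halg := htb.isAlgebraic
  let A := Algebra.adjoin ℂ (Set.range g)
  have hpre : ∀ a : A, ∃ α : MvPolynomial ι ℂ, aeval g α = (a : MvPolynomial ι ℂ) := by
    intro a
    have : (a : MvPolynomial ι ℂ) ∈ Algebra.adjoin ℂ (Set.range g) := a.2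
    rw [Algebra.adjoin_range_eq_range_aeval] at this
    exact this
  choose p hp0 hp using fun i : ι => halg.isAlgebraic (X i : MvPolynomial ι ℂ)
  choose α hα using fun i => hpre (p i).leadingCoeff
  refine ⟨∏ i, α i, ?_, ?_⟩
  · refine Finset.prod_ne_zero_iff.2 fun i _ h0 => ?_
    have := hα i
    rw [h0, map_zero] at this
    exact hp0 i (Polynomial.leadingCoeff_eq_zero.1 (Subtype.ext this.symm))
  intro y hy
  have hyi : ∀ i, eval y (α i) ≠ 0 := by
    rw [map_prod] at hy
    exact fun i => Finset.prod_ne_zero_iff.1 hy i (Finset.mem_univ i)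
  let F := FractionRing (MvPolynomial ι ℂ)
  let f : MvPolynomial ι ℂ →+* F := algebraMap _ _
  have hf : Function.Injective f := IsFractionRing.injective _ _
  let φ : MvPolynomial ι ℂ →+* F := f.comp (aeval g : MvPolynomial ι ℂ →ₐ[ℂ] _).toRingHom
  have hφ : Function.Injective φ := hf.comp hg
  let e : MvPolynomial ι ℂ ≃+* φ.range :=
    RingEquiv.ofBijective φ.rangeRestrict
      ⟨fun a b h => hφ (congrArg Subtype.val h), φ.rangeRestrict_surjective⟩
  let m : Ideal (MvPolynomial ι ℂ) := RingHom.ker (eval y)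
  -- a valuation ring of the function field that dominates the local ring of the target at `y`
  obtain ⟨V, hV, hmV⟩ := Ideal.image_subset_nonunits_valuationSubring
    (m.comap (e.symm : φ.range →+* MvPolynomial ι ℂ))
    (Ideal.comap_ne_top _ (RingHom.ker_ne_top _))
  have hφV : ∀ r, φ r ∈ V := fun r => hV ⟨r, rfl⟩
  have hφm : ∀ r, eval y r = 0 → φ r ∈ V.nonunits := by
    intro r hr
    refine hmV ⟨e r, ?_, rfl⟩
    change e.symm (e r) ∈ m
    rw [e.symm_apply_apply]
    exact hr
  have hunit : ∀ r, eval y r ≠ 0 → V.valuation (φ r) = 1 := by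
    intro r hr
    refine le_antisymm ((V.valuation_le_one_iff _).2 (hφV r)) (not_lt.1 fun hlt => ?_)
    have h1 : φ (r - C (eval y r)) ∈ V.nonunits := hφm _ (by simp)
    have h2 : φ (C (eval y r)) ∈ V.nonunits := by
      have := V.nonunits.sub_mem (V.mem_nonunits_iff.2 hlt) h1
      rwa [← map_sub, sub_sub_cancel] at this
    have h3 : φ (C (eval y r)) * φ (C (eval y r)⁻¹) = 1 := by
      rw [← map_mul, ← C_mul, mul_inv_cancel₀ hr, C_1, map_one]
    have h4 := congrArg V.valuation h3
    rw [map_mul, map_one] at h4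
    exact absurd h4 (mul_lt_one_of_lt_of_le (V.mem_nonunits_iff.1 h2)
      ((V.valuation_le_one_iff _).2 (hφV _))).ne
  -- the coordinates belong to the valuation ring: multiplied by the leading coefficient, a unit of
  -- `V`, they are integral over `V`, which is integrally closed
  have hX : ∀ i, f (X i) ∈ V := by
    intro i
    have hA : ∀ a : A, f a ∈ V := by
      intro a
      obtain ⟨r, hr⟩ := hpre a
      rw [← hr]; exact hφV r
    let ψ : A →+* V := (f.comp A.val.toRingHom).codRestrict V.toSubring hA
    have h0 : Polynomial.aeval (f (X i)) ((p i).map ψ) = 0 := by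
      have := congrArg f (hp i)
      rw [Polynomial.aeval_def, Polynomial.hom_eval₂, map_zero] at this
      rw [Polynomial.aeval_def, Polynomial.eval₂_map]
      exact this
    have hlc : ψ (p i).leadingCoeff ≠ 0 := by
      intro h
      have h' : f ((p i).leadingCoeff : MvPolynomial ι ℂ) = 0 := congrArg Subtype.val h
      rw [map_eq_zero_iff f hf] at h'
      exact hp0 i (Polynomial.leadingCoeff_eq_zero.1 (Subtype.ext h'))
    have h1 := isIntegral_leadingCoeff_smul _ _ h0
    rw [Polynomial.leadingCoeff_map_of_leadingCoeff_ne_zero ψ hlc] at h1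
    obtain ⟨z, hz⟩ := IsIntegrallyClosed.isIntegral_iff.1 h1
    have hz' : (z : F) = φ (α i) * f (X i) := by
      have : φ (α i) = f ((p i).leadingCoeff : MvPolynomial ι ℂ) := congrArg f (hα i)
      rw [this]; exact hz
    rw [← V.valuation_le_one_iff]
    have h2 := (V.valuation_le_one_iff _).2 z.2
    rwa [hz', map_mul, hunit _ (hyi i), one_mul] at h2
  have hfV : ∀ r, f r ∈ V := by
    intro r
    induction r using MvPolynomial.induction_on with
    | C c =>
      have : φ (C c) = f (C c) := congrArg f (aeval_C g c)
      rw [← this]; exact hφV _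
    | add a b ha hb => rw [map_add]; exact V.add_mem _ _ ha hb
    | mul_X a i ha => rw [map_mul]; exact V.mul_mem _ _ ha (hX i)
  let θ : MvPolynomial ι ℂ →+* V := f.codRestrict V.toSubring hfV
  let J : Ideal (MvPolynomial ι ℂ) := (IsLocalRing.maximalIdeal V).comap θ
  have hJ : J ≠ ⊤ := Ideal.comap_ne_top _ (Ideal.IsPrime.ne_top inferInstance)
  have hgJ : ∀ i, g i - C (y i) ∈ J := by
    intro i
    have h1 : φ (X i - C (y i)) ∈ V.nonunits := hφm _ (by simp)
    have h2 : φ (X i - C (y i)) = f (g i - C (y i)) := by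
      change f (aeval g (X i - C (y i))) = _
      simp [algebraMap_eq]
    rw [h2] at h1
    change θ (g i - C (y i)) ∈ IsLocalRing.maximalIdeal V
    rw [← V.coe_mem_nonunits_iff]
    exact h1
  have hne : (zeroLocus ℂ J).Nonempty := by
    by_contra hcon
    have h := vanishingIdeal_zeroLocus_eq_radical (K := ℂ) J
    rw [Set.not_nonempty_iff_eq_empty.1 hcon, vanishingIdeal_empty] at h
    exact hJ (Ideal.radical_eq_top.1 h.symm)
  obtain ⟨x, hx⟩ := hne
  refine ⟨x, funext fun i => ?_⟩
  have := hx _ (hgJ i)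
  simpa [sub_eq_zero, MvPolynomial.aeval_eq_eval] using this

open MvPolynomial in
/-- A polynomial self-map of `ℂⁿ` whose range contains an open set has dense range, as its range
contains the complement of a hypersurface. -/
theorem denseRange_of_interior_range {ι : Type*} [Fintype ι] (g : ι → MvPolynomial ι ℂ)
    (h : (interior (Set.range fun (x : ι → ℂ) i => eval x (g i))).Nonempty) :
    DenseRange fun (x : ι → ℂ) i => eval x (g i) := by
  obtain ⟨α, hα, hαr⟩ := exists_ne_zero_of_algebraicIndependent g
    (algebraicIndependent_of_interior_range g h)
  have hex : ∃ y, eval y α ≠ 0 := by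
    by_contra! hcon
    exact hα (funext fun y => by simpa using hcon y)
  obtain ⟨y₀, hy₀⟩ := hex
  have hd : Differentiable ℂ fun y : ι → ℂ => eval y α :=
    fun y => (AnalyticOnNhd.eval_mvPolynomial α y trivial).differentiableAt
  exact (dense_ne_zero_of_differentiable hd hy₀).mono fun y hy => hαr y hy

/-! ### Orthonormal frames, ranks and null spaces -/

theorem mem_colSpan {m n : Type*} [Fintype n] {A : Matrix m n ℂ} {v : m → ℂ} :
    v ∈ colSpan A ↔ ∃ x, A *ᵥ x = v := by
  have : colSpan A = LinearMap.range A.mulVecLin := by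
    rw [Matrix.range_mulVecLin]; rfl
  rw [this]; rfl

theorem finrank_colSpan {m n : Type*} [Fintype n] (A : Matrix m n ℂ) :
    Module.finrank ℂ (colSpan A) = A.rank := by
  rw [Matrix.rank, Matrix.range_mulVecLin]; rfl

theorem finrank_nullSpace_add_rank {m n : Type*} [Fintype n] (A : Matrix m n ℂ) :
    Module.finrank ℂ (nullSpace A) + A.rank = Fintype.card n := by
  have := A.mulVecLin.finrank_range_add_finrank_ker
  rw [Module.finrank_fintype_fun_eq_card] at this
  rw [nullSpace, Matrix.rank, ← this, add_comm]

theorem finrank_leftNullSpace_add_rank {m n : Type*} [Fintype m] [Fintype n] (A : Matrix m n ℂ) :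
    Module.finrank ℂ (leftNullSpace A) + A.rank = Fintype.card m := by
  have hr : Aᴴ.rank = A.rank := by
    open ComplexOrder in exact Matrix.rank_conjTranspose A
  rw [← hr]
  exact finrank_nullSpace_add_rank Aᴴ

theorem card_le_rank_of_mul_det_ne_zero {m n : Type*} [Fintype m] [Fintype n] [DecidableEq n]
    (T : Matrix n m ℂ) (A : Matrix m n ℂ) (h : (T * A).det ≠ 0) : Fintype.card n ≤ A.rank := by
  rw [← Matrix.rank_of_isUnit (T * A) ((Matrix.isUnit_iff_isUnit_det _).2 h.isUnit)]
  exact Matrix.rank_mul_le_right T A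

theorem rank_of_conjTranspose_mul_self {m n : Type*} [Fintype m] [Fintype n] [DecidableEq n]
    {W : Matrix m n ℂ} (h : Wᴴ * W = 1) : W.rank = Fintype.card n :=
  le_antisymm (Matrix.rank_le_card_width W)
    (card_le_rank_of_mul_det_ne_zero Wᴴ W (by rw [h]; simp))

theorem mem_nullSpace_iff {m n : Type*} [Fintype n] {A : Matrix m n ℂ} {v : n → ℂ} :
    v ∈ nullSpace A ↔ A *ᵥ v = 0 := Iff.rfl

theorem forall_col_mem_nullSpace {m n k : Type*} [Fintype n] {A : Matrix m n ℂ}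
    {W : Matrix n k ℂ} : (∀ c, (fun r => W r c) ∈ nullSpace A) ↔ A * W = 0 := by
  constructor
  · intro h
    ext a c
    exact congrFun (mem_nullSpace_iff.1 (h c)) a
  · intro h c
    rw [mem_nullSpace_iff]
    ext a
    exact congrFun (congrFun h a) c

theorem forall_col_mem_leftNullSpace {m n k : Type*} [Fintype m] {A : Matrix m n ℂ}
    {W : Matrix m k ℂ} : (∀ c, (fun r => W r c) ∈ leftNullSpace A) ↔ Wᴴ * A = 0 := by
  rw [← Matrix.conjTranspose_eq_zero, Matrix.conjTranspose_mul, Matrix.conjTranspose_conjTranspose]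
  exact forall_col_mem_nullSpace

theorem colSpan_le_iff {m n : Type*} {A : Matrix m n ℂ} {S : Submodule ℂ (m → ℂ)} :
    colSpan A ≤ S ↔ ∀ c, (fun r => A r c) ∈ S := by
  rw [colSpan, Submodule.span_le, Set.range_subset_iff]; rfl

theorem col_mem_colSpan {m n : Type*} (A : Matrix m n ℂ) (c : n) :
    (fun r => A r c) ∈ colSpan A := Submodule.subset_span ⟨c, rfl⟩

theorem exists_eq_mul_of_col_mem {m n k : Type*} [Fintype n] {A : Matrix m n ℂ}
    {B : Matrix m k ℂ} (h : ∀ c, (fun r => B r c) ∈ colSpan A) : ∃ C : Matrix n k ℂ, B = A * C := by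
  choose x hx using fun c => mem_colSpan.1 (h c)
  refine ⟨Matrix.of fun r c => x c r, ?_⟩
  ext r c
  exact (congrFun (hx c) r).symm

theorem colSpan_eq_of_orthonormal {m n : Type*} [Fintype m] [Fintype n] [DecidableEq n]
    {W : Matrix m n ℂ} (h : Wᴴ * W = 1) {S : Submodule ℂ (m → ℂ)}
    (hS : ∀ c, (fun r => W r c) ∈ S) (hd : Module.finrank ℂ S ≤ Fintype.card n) :
    colSpan W = S :=
  Submodule.eq_of_le_of_finrank_le (colSpan_le_iff.2 hS)
    (by rwa [finrank_colSpan, rank_of_conjTranspose_mul_self h])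

/-- A subspace of dimension at least `k` contains an orthonormal system of `k` vectors. -/
theorem exists_orthonormal_cols {m : Type*} [Fintype m] {k : ℕ} (S : Submodule ℂ (m → ℂ))
    (h : k ≤ Module.finrank ℂ S) :
    ∃ W : Matrix m (Fin k) ℂ, Wᴴ * W = 1 ∧ ∀ c, (fun r => W r c) ∈ S := by
  let e := (WithLp.linearEquiv 2 ℂ (m → ℂ)).symm
  let S' : Submodule ℂ (EuclideanSpace ℂ m) := S.map e.toLinearMap
  have hS' : Module.finrank ℂ S' = Module.finrank ℂ S := LinearEquiv.finrank_map_eq e S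
  let b := stdOrthonormalBasis ℂ S'
  let i : Fin k → Fin (Module.finrank ℂ S') := Fin.castLE (h.trans hS'.ge)
  refine ⟨Matrix.of fun r c => (b (i c) : EuclideanSpace ℂ m) r, ?_, ?_⟩
  · ext c c'
    have h1 := orthonormal_iff_ite.1 b.orthonormal (i c) (i c')
    rw [Submodule.coe_inner, PiLp.inner_apply] at h1
    rw [Matrix.mul_apply, Matrix.one_apply]
    have h2 : (i c = i c') ↔ c = c' := (Fin.castLE_injective _).eq_iff
    simp only [h2] at h1
    rw [← h1]
    refine Finset.sum_congr rfl fun r _ => ?_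
    simp [mul_comm]
  · intro c
    obtain ⟨v, hv, hvb⟩ := (b (i c)).2
    have : (fun r => (b (i c) : EuclideanSpace ℂ m) r) = v := by
      rw [← hvb]; rfl
    simpa [this] using hv

/-- Orthonormalization of linearly independent columns. -/
theorem exists_orthonormal_mul {m : Type*} [Fintype m] {k : ℕ} (V : Matrix m (Fin k) ℂ)
    (T : Matrix (Fin k) m ℂ) (h : T * V = 1) :
    ∃ C : Matrix (Fin k) (Fin k) ℂ, (V * C)ᴴ * (V * C) = 1 := by
  have hr : k ≤ Module.finrank ℂ (colSpan V) := by
    rw [finrank_colSpan]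
    simpa using card_le_rank_of_mul_det_ne_zero T V (by rw [h]; simp)
  obtain ⟨W, hW, hWV⟩ := exists_orthonormal_cols _ hr
  obtain ⟨C, rfl⟩ := exists_eq_mul_of_col_mem hWV
  exact ⟨C, hW⟩

/-- `A` has a left null space of dimension at least `k` if and only if `k` orthonormal columns fit
into it. -/
theorem rank_add_le_iff {m n : Type*} [Fintype m] [Fintype n] {k : ℕ} (A : Matrix m n ℂ) :
    A.rank + k ≤ Fintype.card m ↔ ∃ U : Matrix m (Fin k) ℂ, Uᴴ * U = 1 ∧ Uᴴ * A = 0 := by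
  have h := finrank_leftNullSpace_add_rank A
  constructor
  · intro hk
    obtain ⟨U, hU, hUA⟩ := exists_orthonormal_cols (k := k) (leftNullSpace A) (by omega)
    exact ⟨U, hU, forall_col_mem_leftNullSpace.1 hUA⟩
  · rintro ⟨U, hU, hUA⟩
    have h1 := Submodule.finrank_mono (colSpan_le_iff.2 (forall_col_mem_leftNullSpace.2 hUA))
    rw [finrank_colSpan, rank_of_conjTranspose_mul_self hU, Fintype.card_fin] at h1
    omega

/-- The rank of `A * B` depends on `A` only through its row space. -/
theorem rank_mul_eq_finrank_map {m n k : Type*} [Fintype m] [Fintype n] [Fintype k]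
    (A : Matrix m n ℂ) (B : Matrix n k ℂ) :
    (A * B).rank = Module.finrank ℂ ((colSpan Aᵀ).map Bᵀ.mulVecLin) := by
  have : colSpan Aᵀ = LinearMap.range Aᵀ.mulVecLin := by
    rw [Matrix.range_mulVecLin]; rfl
  rw [← Matrix.rank_transpose, Matrix.transpose_mul, Matrix.rank, Matrix.mulVecLin_mul,
    LinearMap.range_comp, this]

/-- The matrices with orthonormal columns. -/
def stiefel (m n : Type*) [Fintype m] [Fintype n] [DecidableEq n] : Set (Matrix m n ℂ) :=
  {W | Wᴴ * W = 1}

theorem isCompact_stiefel (m n : Type*) [Fintype m] [Fintype n] [DecidableEq n] :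
    IsCompact (stiefel m n) := by
  have hK : IsCompact (Set.pi Set.univ fun _ : m => Set.pi Set.univ fun _ : n =>
      Metric.closedBall (0 : ℂ) 1) :=
    isCompact_univ_pi fun _ => isCompact_univ_pi fun _ => isCompact_closedBall _ _
  refine IsCompact.of_isClosed_subset (X := m → n → ℂ) hK ?_ ?_
  · exact isClosed_eq (f := fun W : Matrix m n ℂ => Wᴴ * W)
      (g := fun _ => (1 : Matrix n n ℂ)) (by fun_prop) (by fun_prop)
  · intro (W : Matrix m n ℂ) hW r _ c _
    have h1 : (Wᴴ * W) c c = 1 := by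
      rw [show Wᴴ * W = 1 from hW]; simp
    have h2 : ∑ r, ‖W r c‖ ^ 2 = 1 := by
      rw [Matrix.mul_apply] at h1
      have h3 : ((∑ r, ‖W r c‖ ^ 2 : ℝ) : ℂ) = 1 := by
        rw [← h1]
        push_cast
        refine Finset.sum_congr rfl fun r _ => ?_
        rw [Matrix.conjTranspose_apply, ← Complex.conj_mul']; rfl
      exact_mod_cast h3
    have h3 : ‖W r c‖ ^ 2 ≤ 1 := by
      rw [← h2]
      exact Finset.single_le_sum (f := fun r => ‖W r c‖ ^ 2) (fun _ _ => by positivity)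
        (Finset.mem_univ r)
    rw [mem_closedBall_zero_iff]
    nlinarith [norm_nonneg (W r c)]

theorem isCompact_pi_stiefel {ι : Type*} (m n : ι → Type*) [∀ i, Fintype (m i)]
    [∀ i, Fintype (n i)] [∀ i, DecidableEq (n i)] :
    IsCompact {W : ∀ i, Matrix (m i) (n i) ℂ | ∀ i, (W i)ᴴ * W i = 1} := by
  have := isCompact_univ_pi fun i => isCompact_stiefel (m i) (n i)
  convert this using 1
  ext W; simp [stiefel]

theorem differentiable_det {E n : Type*} [NormedAddCommGroup E] [NormedSpace ℂ E] [Fintype n]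
    [DecidableEq n] {A : E → Matrix n n ℂ} (h : ∀ a b, Differentiable ℂ fun x => A x a b) :
    Differentiable ℂ fun x => (A x).det := by
  simp only [Matrix.det_apply]
  refine Differentiable.fun_sum fun σ _ => ?_
  refine Differentiable.const_smul ?_ _
  have : Differentiable ℂ fun x => ∏ i, A x (σ i) i := by fun_prop
  exact this

theorem differentiable_mul_apply {E m n k : Type*} [NormedAddCommGroup E] [NormedSpace ℂ E]
    [Fintype n] {A : E → Matrix m n ℂ} {B : E → Matrix n k ℂ}
    (hA : ∀ a b, Differentiable ℂ fun x => A x a b)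
    (hB : ∀ a b, Differentiable ℂ fun x => B x a b) (a : m) (b : k) :
    Differentiable ℂ fun x => (A x * B x) a b := by
  simp only [Matrix.mul_apply]
  exact Differentiable.fun_sum fun c _ => (hA a c).mul (hB c b)

/-- Matrices with orthonormal columns exist in all shapes with no more columns than rows. -/
theorem exists_isometry_of_card_le {m n : Type*} [Fintype m] [Fintype n] [DecidableEq n]
    (h : Fintype.card n ≤ Fintype.card m) : ∃ W : Matrix m n ℂ, Wᴴ * W = 1 := by
  classical
  obtain ⟨f⟩ := Function.Embedding.nonempty_of_card_le h
  refine ⟨Matrix.of fun a b => if a = f b then 1 else 0, ?_⟩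
  ext b b'
  rw [Matrix.mul_apply, Matrix.one_apply]
  simp [f.injective.eq_iff, eq_comm]

/-! ### Alignment of the strategy IV links for all matrices `G` -/

/-- A small nonlinear perturbation of an invertible linear map has an open set in its range. -/
theorem interior_range_nonempty {ι : Type*} [Fintype ι] [DecidableEq ι] (B : Matrix ι ι ℂ)
    (hB : IsUnit B.det) (q : (ι → ℂ) → ι → ℂ)
    (hq : HasStrictFDerivAt q (0 : (ι → ℂ) →L[ℂ] (ι → ℂ)) 0) :
    (interior (Set.range fun z => -(B *ᵥ z + q z))).Nonempty := by
  let e : (ι → ℂ) ≃L[ℂ] (ι → ℂ) :=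
    (Matrix.toLinearEquiv' B ((Matrix.isUnit_iff_isUnit_det B).2 hB).invertible
      |>.toContinuousLinearEquiv).trans (ContinuousLinearEquiv.neg ℂ)
  have he : ∀ z, e z = -(B *ᵥ z) := fun _ => rfl
  have h1 : HasStrictFDerivAt (fun z => -(B *ᵥ z + q z)) (e : (ι → ℂ) →L[ℂ] (ι → ℂ)) 0 := by
    have h2 := (e : (ι → ℂ) →L[ℂ] (ι → ℂ)).hasStrictFDerivAt (x := 0) |>.sub hq
    rw [sub_zero] at h2
    have h3 : (fun z => -(B *ᵥ z + q z)) = (e : (ι → ℂ) →L[ℂ] (ι → ℂ)) - q := by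
      funext z
      change _ = e z - q z
      rw [he]; abel
    rw [h3]; exact h2
  have h2 := h1.map_nhds_eq_of_equiv
  refine ⟨-(B *ᵥ 0 + q 0), mem_interior_iff_mem_nhds.2 ?_⟩
  rw [← h2]; exact Filter.range_mem_map

theorem hasStrictFDerivAt_zero_mul {E : Type*} [NormedAddCommGroup E] [NormedSpace ℂ E]
    (a b : E →L[ℂ] ℂ) : HasStrictFDerivAt (fun z => a z * b z) (0 : E →L[ℂ] ℂ) 0 := by
  have h := (a.hasStrictFDerivAt (x := 0)).fun_mul (b.hasStrictFDerivAt (x := 0))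
  refine h.congr_fderiv ?_
  ext z
  simp

theorem sum_eq_first_add_last {a b : ℕ} (h : a ≤ b) (f : Fin b → ℂ) :
    ∑ x, f x = ∑ x, f (firstIdx h x) + ∑ x, f (lastIdx h x) := by
  have hb : a + (b - a) = b := by omega
  rw [← (finCongr hb).sum_comp, Fin.sum_univ_add]
  congr 1

namespace Profile

variable {K : ℕ} {M N : Fin K → ℕ} {L : Profile M N} {d : Fin K → ℕ}

/-- The scalar alignment equations: one for each link `(j, i)` under strategy IV and
each entry of a `d_j^0 × d_i` matrix, addressed by (column, row). -/
abbrev Equations (L : Profile M N) (d : Fin K → ℕ) : Type :=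
  Σ e : (Σ j : Fin K, {i // i ∈ L.ΩIV j}), Fin (d e.2) × Fin (L.d0 d e.1)

/-- All matrices `X_{ji}`, `i ∈ Ω_j^IV`, on top of each other. -/
def Xall (hM : ∀ j, (L.d0 d j : ℤ) ≤ L.Me j) (hN : ∀ i, (d i : ℤ) ≤ L.Ne i) (G : L.GFamily) :
    Matrix (L.Equations d) (L.Unknowns d) ℂ :=
  Matrix.of fun r c => X hM hN G r.1.1 r.1.2 r.2 c

/-- Independence as the non-vanishing of a determinant that is polynomial in `G`. -/
theorem rowsIndependent_iff {hM : ∀ j, (L.d0 d j : ℤ) ≤ L.Me j} {hN : ∀ i, (d i : ℤ) ≤ L.Ne i}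
    {G : L.GFamily} :
    RowsIndependent hM hN G ↔ ∃ Y : Matrix (L.Unknowns d) (L.Equations d) ℂ,
      (Xall hM hN G * Y).det ≠ 0 := by
  change LinearIndependent ℂ (Xall hM hN G).row ↔ _
  constructor
  · intro h
    have h1 : LinearMap.range (Xall hM hN G).mulVecLin = ⊤ :=
      Submodule.eq_top_of_finrank_eq
        (h.rank_matrix.trans (Module.finrank_fintype_fun_eq_card ℂ).symm)
    obtain ⟨Y, hY⟩ := Matrix.mulVec_surjective_iff_exists_right_inverse.1
      (LinearMap.range_eq_top.1 h1)
    exact ⟨Y, by rw [hY]; simp⟩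
  · rintro ⟨Y, hY⟩
    rw [← Matrix.vecMul_injective_iff]
    refine Function.LeftInverse.injective
      (g := fun v => v ᵥ* (Y * (Xall hM hN G * Y)⁻¹)) fun v => ?_
    change (v ᵥ* Xall hM hN G) ᵥ* (Y * (Xall hM hN G * Y)⁻¹) = v
    rw [Matrix.vecMul_vecMul, ← Matrix.mul_assoc, Matrix.mul_nonsing_inv _ hY.isUnit,
      Matrix.vecMul_one]

/-- The matrix `Ũ_j†` contained in a vector of unknowns. -/
def uPart (x : L.Unknowns d → ℂ) (j : Fin K) :
    Matrix (Fin (L.d0 d j)) (Fin (L.me j - L.d0 d j)) ℂ :=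
  Matrix.of fun l r => x (Sum.inl ⟨j, (r, l)⟩)

/-- The matrix `Ṽ_i` contained in a vector of unknowns. -/
def vPart (x : L.Unknowns d → ℂ) (i : Fin K) : Matrix (Fin (L.ne i - d i)) (Fin (d i)) ℂ :=
  Matrix.of fun s k => x (Sum.inr ⟨i, (k, s)⟩)

theorem X_mulVec (hM : ∀ j, (L.d0 d j : ℤ) ≤ L.Me j) (hN : ∀ i, (d i : ℤ) ≤ L.Ne i)
    (G : L.GFamily) (x : L.Unknowns d → ℂ) (j i : Fin K) (k : Fin (d i)) (l : Fin (L.d0 d j)) :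
    (X hM hN G j i *ᵥ x) (k, l) =
      (uPart x j * G2 hM hN G j i) l k + (G3 hM hN G j i * vPart x i) l k := by
  simp only [Matrix.mulVec, dotProduct, Fintype.sum_sum_type, Fintype.sum_sigma]
  congr 1
  · rw [Finset.sum_eq_single j (fun p _ hp => by simp [X, hp]) (by simp)]
    simp [X, Fintype.sum_prod_type, Matrix.mul_apply, uPart, Matrix.one_apply, mul_comm]
  · rw [Finset.sum_eq_single i (fun p _ hp => by simp [X, hp]) (by simp)]
    simp [X, Fintype.sum_prod_type, Matrix.mul_apply, vPart, Matrix.one_apply]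

/-- The upper left block `G_{ji}^{(1)}`. -/
def G1 (hM : ∀ j, (L.d0 d j : ℤ) ≤ L.Me j) (hN : ∀ i, (d i : ℤ) ≤ L.Ne i) (G : L.GFamily)
    (j i : Fin K) : Matrix (Fin (L.d0 d j)) (Fin (d i)) ℂ :=
  (G j i).submatrix (firstIdx (le_me (hM j))) (firstIdx (le_ne (hN i)))

/-- The lower right block `G_{ji}^{(4)}`. -/
def G4 (hM : ∀ j, (L.d0 d j : ℤ) ≤ L.Me j) (hN : ∀ i, (d i : ℤ) ≤ L.Ne i) (G : L.GFamily)
    (j i : Fin K) : Matrix (Fin (L.me j - L.d0 d j)) (Fin (L.ne i - d i)) ℂ :=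
  (G j i).submatrix (lastIdx (le_me (hM j))) (lastIdx (le_ne (hN i)))

/-- The matrix `[I, A]` with `b` columns. -/
def idBeside {a : ℕ} (b : ℕ) (A : Matrix (Fin a) (Fin (b - a)) ℂ) : Matrix (Fin a) (Fin b) ℂ :=
  Matrix.of fun l c => if h : (c : ℕ) < a then (1 : Matrix (Fin a) (Fin a) ℂ) l ⟨c, h⟩
    else A l ⟨c - a, by omega⟩

theorem idBeside_first {a b : ℕ} (h : a ≤ b) (A : Matrix (Fin a) (Fin (b - a)) ℂ)
    (l c : Fin a) : idBeside b A l (firstIdx h c) = (1 : Matrix (Fin a) (Fin a) ℂ) l c := by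
  simp [idBeside, firstIdx]
  rfl

theorem idBeside_last {a b : ℕ} (h : a ≤ b) (A : Matrix (Fin a) (Fin (b - a)) ℂ)
    (l : Fin a) (c : Fin (b - a)) : idBeside b A l (lastIdx h c) = A l c := by
  simp [idBeside, lastIdx]

theorem idBeside_mul {a b : ℕ} (h : a ≤ b) {k : Type*} (A : Matrix (Fin a) (Fin (b - a)) ℂ)
    (B : Matrix (Fin b) k ℂ) :
    idBeside b A * B = B.submatrix (firstIdx h) id + A * B.submatrix (lastIdx h) id := by
  ext l c
  rw [Matrix.mul_apply, sum_eq_first_add_last h]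
  simp [idBeside_first, idBeside_last, Matrix.one_apply, Matrix.mul_apply]

theorem idBeside_mul_transpose {a b : ℕ} (h : a ≤ b) (A : Matrix (Fin a) (Fin (b - a)) ℂ) :
    idBeside b A * (idBeside b (0 : Matrix (Fin a) (Fin (b - a)) ℂ))ᵀ = 1 := by
  rw [idBeside_mul h]
  have h1 : ((idBeside b (0 : Matrix (Fin a) (Fin (b - a)) ℂ))ᵀ).submatrix (firstIdx h) id = 1 := by
    ext l c; simp [idBeside_first, Matrix.one_apply, eq_comm]
  have h2 : ((idBeside b (0 : Matrix (Fin a) (Fin (b - a)) ℂ))ᵀ).submatrix (lastIdx h) id = 0 := by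
    ext l c; simp [idBeside_last]
  rw [h1, h2]; simp

/-- The alignment condition for `U_j† = [I, Ũ_j†]` and `V_i = [I; Ṽ_i]` in block form. -/
theorem idBeside_mul_mul (hM : ∀ j, (L.d0 d j : ℤ) ≤ L.Me j) (hN : ∀ i, (d i : ℤ) ≤ L.Ne i)
    (G : L.GFamily) (j i : Fin K) (u : Matrix (Fin (L.d0 d j)) (Fin (L.me j - L.d0 d j)) ℂ)
    (v : Matrix (Fin (L.ne i - d i)) (Fin (d i)) ℂ) :
    idBeside (L.me j) u * G j i * (idBeside (L.ne i) vᵀ)ᵀ =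
      G1 hM hN G j i + (u * G2 hM hN G j i + G3 hM hN G j i * v) + u * G4 hM hN G j i * v := by
  rw [idBeside_mul (le_me (hM j)), ← Matrix.transpose_inj, Matrix.transpose_mul,
    Matrix.transpose_transpose, idBeside_mul (le_ne (hN i)), ← Matrix.transpose_inj]
  ext l k
  simp only [Matrix.transpose_apply, Matrix.add_apply, Matrix.mul_apply, Matrix.submatrix_apply,
    id, G1, G2, G3, G4, mul_add, Finset.sum_add_distrib, Finset.sum_mul, Finset.mul_sum]
  have h1 : ∀ x y, v x k * (u l y * G j i (lastIdx (le_me (hM j)) y) (lastIdx (le_ne (hN i)) x)) =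
      u l y * G j i (lastIdx (le_me (hM j)) y) (lastIdx (le_ne (hN i)) x) * v x k :=
    fun x y => mul_comm _ _
  simp only [h1, mul_comm (v _ k) (G j i _ _)]
  ring

/-- The strategy IV links of `G` can be aligned: there are orthonormal `V_i^a` and `U_j^a` with
`d_i` and `d_j^0` columns such that `(U_j^a)† G_{ji} V_i^a = 0`. -/
def AlignableIV (d : Fin K → ℕ) (G : L.GFamily) : Prop :=
  ∃ (Va : ∀ i, Matrix (Fin (L.ne i)) (Fin (d i)) ℂ)
    (Ua : ∀ j, Matrix (Fin (L.me j)) (Fin (L.d0 d j)) ℂ),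
    (∀ i, (Va i)ᴴ * Va i = 1) ∧ (∀ j, (Ua j)ᴴ * Ua j = 1) ∧
      ∀ j, ∀ i ∈ L.ΩIV j, (Ua j)ᴴ * G j i * Va i = 0

theorem isClosed_alignableIV : IsClosed {G : L.GFamily | AlignableIV d G} := by
  have h := isClosed_exists_mem_compact (X := L.GFamily)
    ((isCompact_pi_stiefel (fun i => Fin (L.ne i)) (fun i => Fin (d i))).prod
      (isCompact_pi_stiefel (fun j => Fin (L.me j)) (fun j => Fin (L.d0 d j))))
    (C := {p | ∀ j, ∀ i ∈ L.ΩIV j, (p.2.2 j)ᴴ * p.1 j i * p.2.1 i = 0}) (by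
      simp only [Set.ofPred_forall]
      refine isClosed_iInter fun j => isClosed_iInter fun i => isClosed_iInter fun _ => ?_
      exact isClosed_eq (by fun_prop) (by fun_prop))
  convert h using 1
  ext G
  constructor
  · rintro ⟨Va, Ua, h1, h2, h3⟩
    exact ⟨(Va, Ua), ⟨h1, h2⟩, h3⟩
  · rintro ⟨⟨Va, Ua⟩, ⟨h1, h2⟩, h3⟩
    exact ⟨Va, Ua, h1, h2, h3⟩

/-- Matrices `U_j = [I; Ũ_j]` and `V_i = [I; Ṽ_i]` that solve the alignment equations may be
orthonormalized without changing their column spaces. -/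
theorem alignableIV_of_blocks (hM : ∀ j, (L.d0 d j : ℤ) ≤ L.Me j)
    (hN : ∀ i, (d i : ℤ) ≤ L.Ne i) (G : L.GFamily)
    (u : ∀ j, Matrix (Fin (L.d0 d j)) (Fin (L.me j - L.d0 d j)) ℂ)
    (v : ∀ i, Matrix (Fin (L.ne i - d i)) (Fin (d i)) ℂ)
    (h : ∀ j, ∀ i ∈ L.ΩIV j, G1 hM hN G j i + (u j * G2 hM hN G j i + G3 hM hN G j i * v i) +
      u j * G4 hM hN G j i * v i = 0) : AlignableIV d G := by
  have h1 := fun i => exists_orthonormal_mul ((idBeside (L.ne i) (v i)ᵀ)ᵀ) (idBeside (L.ne i) 0)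
    (by rw [← Matrix.transpose_inj, Matrix.transpose_mul, Matrix.transpose_transpose,
          idBeside_mul_transpose (le_ne (hN i)), Matrix.transpose_one])
  have h2 := fun j => exists_orthonormal_mul ((idBeside (L.me j) (u j))ᴴ)
    (((idBeside (L.me j) (0 : Matrix (Fin (L.d0 d j)) (Fin (L.me j - L.d0 d j)) ℂ))ᵀ)ᴴ)
    (by rw [← Matrix.conjTranspose_mul, idBeside_mul_transpose (le_me (hM j)),
          Matrix.conjTranspose_one])
  choose C hC using h1
  choose D hD using h2
  refine ⟨_, _, hC, hD, fun j i hi => ?_⟩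
  rw [Matrix.conjTranspose_mul, Matrix.conjTranspose_conjTranspose, Matrix.mul_assoc (D j)ᴴ,
    Matrix.mul_assoc (D j)ᴴ, ← Matrix.mul_assoc _ _ (C i), idBeside_mul_mul hM hN, h j i hi,
    Matrix.zero_mul, Matrix.mul_zero]

/-- Replace the blocks `G_{ji}^{(1)}`, `i ∈ Ω_j^IV`, by prescribed ones. -/
def replaceG1 (G : L.GFamily) (y : L.Equations d → ℂ) : L.GFamily :=
  fun j i => Matrix.of fun a b =>
    if h : i ∈ L.ΩIV j ∧ (a : ℕ) < L.d0 d j ∧ (b : ℕ) < d i then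
      y ⟨⟨j, ⟨i, h.1⟩⟩, (⟨b, h.2.2⟩, ⟨a, h.2.1⟩)⟩
    else G j i a b

theorem continuous_replaceG1 (G : L.GFamily) :
    Continuous fun y : L.Equations d → ℂ => replaceG1 G y := by
  refine continuous_pi fun j => continuous_pi fun i => continuous_pi fun a => continuous_pi fun b =>
    ?_
  change Continuous fun y : L.Equations d → ℂ =>
    if h : i ∈ L.ΩIV j ∧ (a : ℕ) < L.d0 d j ∧ (b : ℕ) < d i then
      y ⟨⟨j, ⟨i, h.1⟩⟩, (⟨b, h.2.2⟩, ⟨a, h.2.1⟩)⟩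
    else G j i a b
  split_ifs <;> fun_prop

section Blocks

variable (hM : ∀ j, (L.d0 d j : ℤ) ≤ L.Me j) (hN : ∀ i, (d i : ℤ) ≤ L.Ne i) (G : L.GFamily)
  (y : L.Equations d → ℂ) (j i : Fin K)

theorem G1_replaceG1 (hi : i ∈ L.ΩIV j) (l k) :
    G1 hM hN (replaceG1 G y) j i l k = y ⟨⟨j, ⟨i, hi⟩⟩, (k, l)⟩ := by
  simp [G1, replaceG1, firstIdx, hi]

theorem G2_replaceG1 : G2 hM hN (replaceG1 G y) j i = G2 hM hN G j i := by
  ext; simp [G2, replaceG1, lastIdx]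

theorem G3_replaceG1 : G3 hM hN (replaceG1 G y) j i = G3 hM hN G j i := by
  ext; simp [G3, replaceG1, lastIdx]

theorem G4_replaceG1 : G4 hM hN (replaceG1 G y) j i = G4 hM hN G j i := by
  ext; simp [G4, replaceG1, lastIdx]

theorem replaceG1_self :
    replaceG1 G (fun r : L.Equations d => G1 hM hN G r.1.1 r.1.2 r.2.2 r.2.1) = G := by
  funext j i
  ext a b
  simp [replaceG1, G1, firstIdx]

end Blocks

/-- If the unknowns can be restricted so that the linear part of the alignment
equations becomes invertible, then the equations can be solved for a dense set of constant terms
`G_{ji}^{(1)}`, hence, by compactness, for all of them. -/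
theorem alignableIV_of_det_ne_zero (hM : ∀ j, (L.d0 d j : ℤ) ≤ L.Me j)
    (hN : ∀ i, (d i : ℤ) ≤ L.Ne i) (G : L.GFamily)
    (Y : Matrix (L.Unknowns d) (L.Equations d) ℂ) (hY : (Xall hM hN G * Y).det ≠ 0) :
    AlignableIV d G := by
  let q : (L.Equations d → ℂ) → L.Equations d → ℂ := fun z r =>
    ∑ s, (∑ t, (Y *ᵥ z) (Sum.inl ⟨r.1.1, (t, r.2.2)⟩) * G4 hM hN G r.1.1 r.1.2 t s) *
      (Y *ᵥ z) (Sum.inr ⟨r.1.2, (r.2.1, s)⟩)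
  let p : L.Unknowns d → MvPolynomial (L.Equations d) ℂ := fun c =>
    ∑ t, MvPolynomial.C (Y c t) * MvPolynomial.X t
  have hp : ∀ z c, MvPolynomial.eval z (p c) = (Y *ᵥ z) c := fun z c => by
    simp [p, Matrix.mulVec, dotProduct]
  let g : L.Equations d → MvPolynomial (L.Equations d) ℂ := fun r =>
    -(∑ c, MvPolynomial.C (Xall hM hN G r c) * p c +
      ∑ s, (∑ t, p (Sum.inl ⟨r.1.1, (t, r.2.2)⟩) *
        MvPolynomial.C (G4 hM hN G r.1.1 r.1.2 t s)) * p (Sum.inr ⟨r.1.2, (r.2.1, s)⟩))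
  have hg : ∀ z : L.Equations d → ℂ, (fun r => MvPolynomial.eval z (g r)) =
      -((Xall hM hN G * Y) *ᵥ z + q z) := by
    intro z
    funext r
    simp [g, q, hp, ← Matrix.mulVec_mulVec, Matrix.mulVec, dotProduct]
  have hq : HasStrictFDerivAt q (0 : (L.Equations d → ℂ) →L[ℂ] (L.Equations d → ℂ)) 0 := by
    refine hasStrictFDerivAt_pi'.2 fun r => ?_
    let a : L.Unknowns d → ((L.Equations d → ℂ) →L[ℂ] ℂ) := fun c =>
      LinearMap.toContinuousLinearMap (LinearMap.proj c ∘ₗ Y.mulVecLin)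
    have ha : ∀ c z, a c z = (Y *ᵥ z) c := fun c z => rfl
    have h1 := HasStrictFDerivAt.fun_sum (u := Finset.univ) (x := 0) fun s _ =>
      hasStrictFDerivAt_zero_mul
        (∑ t, G4 hM hN G r.1.1 r.1.2 t s • a (Sum.inl ⟨r.1.1, (t, r.2.2)⟩))
        (a (Sum.inr ⟨r.1.2, (r.2.1, s)⟩))
    simp only [Finset.sum_const_zero] at h1
    have h2 : (fun z => q z r) = fun z => ∑ s,
        (∑ t, G4 hM hN G r.1.1 r.1.2 t s • a (Sum.inl ⟨r.1.1, (t, r.2.2)⟩)) z *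
          a (Sum.inr ⟨r.1.2, (r.2.1, s)⟩) z := by
      funext z
      refine Finset.sum_congr rfl fun s _ => ?_
      rw [_root_.sum_apply, ha]
      congr 1
      exact Finset.sum_congr rfl fun t _ => mul_comm _ _
    rw [h2]
    exact h1
  have hdense : DenseRange fun (z : L.Equations d → ℂ) r => MvPolynomial.eval z (g r) := by
    refine denseRange_of_interior_range g ?_
    rw [show (fun (z : L.Equations d → ℂ) r => MvPolynomial.eval z (g r)) =
      fun z => -((Xall hM hN G * Y) *ᵥ z + q z) from funext hg]
    exact interior_range_nonempty _ hY.isUnit q hq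
  have hclosed : IsClosed {y : L.Equations d → ℂ | AlignableIV d (replaceG1 G y)} :=
    isClosed_alignableIV.preimage (continuous_replaceG1 G)
  have hsub : Set.range (fun (z : L.Equations d → ℂ) r => MvPolynomial.eval z (g r)) ⊆
      {y : L.Equations d → ℂ | AlignableIV d (replaceG1 G y)} := by
    rintro y ⟨z, hz⟩
    refine alignableIV_of_blocks hM hN _ (uPart (Y *ᵥ z)) (vPart (Y *ᵥ z)) fun j i hi => ?_
    rw [G2_replaceG1, G3_replaceG1, G4_replaceG1]
    ext l k
    have h1 : y ⟨⟨j, ⟨i, hi⟩⟩, (k, l)⟩ =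
        -((X hM hN G j i *ᵥ (Y *ᵥ z)) (k, l) + q z ⟨⟨j, ⟨i, hi⟩⟩, (k, l)⟩) := by
      refine (congrFun (hz.symm.trans (hg z)) _).trans ?_
      rw [← Matrix.mulVec_mulVec]; rfl
    rw [Matrix.add_apply, Matrix.add_apply, Matrix.add_apply, ← X_mulVec, G1_replaceG1 (hi := hi),
      h1, Matrix.zero_apply]
    have : q z ⟨⟨j, ⟨i, hi⟩⟩, (k, l)⟩ =
        (uPart (Y *ᵥ z) j * G4 hM hN G j i * vPart (Y *ᵥ z) i) l k := by
      simp [q, uPart, vPart, Matrix.mul_apply]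
    rw [this]; ring
  have huniv := hclosed.closure_subset_iff.2 hsub
  rw [hdense.closure_range] at huniv
  have := huniv (Set.mem_univ fun r : L.Equations d => G1 hM hN G r.1.1 r.1.2 r.2.2 r.2.1)
  rwa [Set.mem_ofPred_eq, replaceG1_self] at this

theorem differentiable_Xall {E : Type*} [NormedAddCommGroup E] [NormedSpace ℂ E]
    (hM : ∀ j, (L.d0 d j : ℤ) ≤ L.Me j) (hN : ∀ i, (d i : ℤ) ≤ L.Ne i) {G : E → L.GFamily}
    (hG : ∀ j i a b, Differentiable ℂ fun x => G x j i a b) (r : L.Equations d)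
    (c : L.Unknowns d) : Differentiable ℂ fun x => Xall hM hN (G x) r c := by
  obtain ⟨⟨j, i⟩, k, l⟩ := r
  rcases c with ⟨p, t, l'⟩ | ⟨p, k', s⟩
  · by_cases hp : p = j
    · subst hp
      simp only [Xall, X, Matrix.of_apply, dite_true, Matrix.kroneckerMap_apply,
        Matrix.transpose_apply, G2, Matrix.submatrix_apply]
      exact (hG _ _ _ _).mul_const _
    · simp [Xall, X, hp]
  · by_cases hp : p = i
    · subst hp
      simp only [Xall, X, Matrix.of_apply, dite_true, Matrix.kroneckerMap_apply,
        G3, Matrix.submatrix_apply]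
      exact (hG _ _ _ _).const_mul _
    · simp [Xall, X, hp]

/-- If independence holds for one family of matrices, then the strategy IV links can be aligned
for every family. -/
theorem alignableIV_of_rowsIndependent (hM : ∀ j, (L.d0 d j : ℤ) ≤ L.Me j)
    (hN : ∀ i, (d i : ℤ) ≤ L.Ne i) {G₀ : L.GFamily} (h₀ : RowsIndependent hM hN G₀)
    (G : L.GFamily) : AlignableIV d G := by
  obtain ⟨Y, hY⟩ := rowsIndependent_iff.1 h₀
  let E := ∀ j i : Fin K, Fin (L.me j) → Fin (L.ne i) → ℂ
  have hd : Differentiable ℂ fun G : E =>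
      (Xall hM hN (fun j i => Matrix.of (G j i) : L.GFamily) * Y).det :=
    differentiable_det fun a b => differentiable_mul_apply
      (fun r c => differentiable_Xall hM hN (fun j i a b => by
        simp only [Matrix.of_apply]; fun_prop) r c) (fun _ _ => by fun_prop) a b
  have hdense := dense_ne_zero_of_differentiable hd (x₀ := G₀) hY
  have hc : IsClosed {G : E | AlignableIV d (fun j i => Matrix.of (G j i) : L.GFamily)} :=
    isClosed_alignableIV
  exact hc.closure_subset_iff.2 (fun G hG => alignableIV_of_det_ne_zero hM hN _ Y hG) (hdense G)

/-! ### Frames -/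

theorem card_concatII (hM : ∀ j, (L.d0 d j : ℤ) ≤ L.Me j) (j : Fin K) :
    L.me j + Fintype.card (Σ i : {i // i ∈ L.ΩII j}, Fin (L.Ns i)) = L.Ms j := by
  have h1 : Fintype.card (Σ i : {i // i ∈ L.ΩII j}, Fin (L.Ns i)) = ∑ i ∈ L.ΩII j, L.Ns i := by
    rw [Fintype.card_sigma, ← Finset.sum_coe_sort (L.ΩII j)]
    simp
  have h2 := hM j
  rw [h1]
  unfold me Me at *
  push_cast [← Nat.cast_sum] at *
  omega

theorem card_stackIII (hM : ∀ j, (L.d0 d j : ℤ) ≤ L.Me j) (hN : ∀ i, (d i : ℤ) ≤ L.Ne i)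
    (i : Fin K) :
    L.ne i + Fintype.card (Σ j : {j // i ∈ L.ΩIII j}, Fin (L.me j)) = L.Ns i := by
  have h1 : Fintype.card (Σ j : {j // i ∈ L.ΩIII j}, Fin (L.me j)) =
      ∑ j with i ∈ L.ΩIII j, L.me j := by
    rw [Fintype.card_sigma, ← Finset.sum_subtype_eq_sum_filter]
    simp
  have h2 : ((∑ j with i ∈ L.ΩIII j, L.me j : ℕ) : ℤ) = ∑ j with i ∈ L.ΩIII j, L.Me j := by
    push_cast
    refine Finset.sum_congr rfl fun j _ => ?_
    have := hM j
    unfold me; omega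
  have h3 := hN i
  rw [h1]
  unfold ne Ne at *
  omega

/-- The matrices `(S_j^r)† H_{ji}^s`, `i ∈ Ω_j^III`, for fixed `i`, on top of each other. -/
def stackIII (L : Profile M N) (H : Channel M N) (Sr : L.RxFrames) (i : Fin K) :
    Matrix (Σ j : {j // i ∈ L.ΩIII j}, Fin (L.me j)) (Fin (L.Ns i)) ℂ :=
  Matrix.of fun r c => ((Sr r.1)ᴴ * L.Hs H r.1 i) r.2 c

theorem nullSpace_stackIII (H : Channel M N) (Sr : L.RxFrames) (i : Fin K) :
    nullSpace (L.stackIII H Sr i) =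
      ⨅ j : {j // i ∈ L.ΩIII j}, nullSpace ((Sr j)ᴴ * L.Hs H j i) := by
  ext v
  simp only [Submodule.mem_iInf, mem_nullSpace_iff]
  constructor
  · intro h j
    ext a
    exact congrFun h ⟨j, a⟩
  · intro h
    ext ⟨j, a⟩
    exact congrFun (h j) a

theorem mul_concatII_eq_zero_iff {H : Channel M N} {j : Fin K} {k : Type*}
    (A : Matrix k (Fin (L.Ms j)) ℂ) :
    A * L.concatII H j = 0 ↔ ∀ i ∈ L.ΩII j, A * L.Hs H j i = 0 := by
  constructor
  · intro h i hi
    ext a b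
    exact congrFun (congrFun h a) ⟨⟨i, hi⟩, b⟩
  · intro h
    ext a ⟨⟨i, hi⟩, b⟩
    exact congrFun (congrFun (h i hi) a) b

/-- `S_j^r` has orthonormal columns in the left null space of the strategy II links.  They span that
null space when its dimension is the generic one. -/
def WeakRx (H : Channel M N) (Sr : L.RxFrames) : Prop :=
  (∀ j, (Sr j)ᴴ * Sr j = 1) ∧ ∀ j, ∀ i ∈ L.ΩII j, (Sr j)ᴴ * L.Hs H j i = 0

/-- `S_i^t` has orthonormal columns in the null spaces of the matrices `(S_j^r)† H_{ji}^s`,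
`i ∈ Ω_j^III`. -/
def WeakTx (H : Channel M N) (Sr : L.RxFrames) (St : L.TxFrames) : Prop :=
  (∀ i, (St i)ᴴ * St i = 1) ∧ ∀ j, ∀ i ∈ L.ΩIII j, (Sr j)ᴴ * L.Hs H j i * St i = 0

/-- Orthonormal columns in the left null space of the strategy II links exist for every channel, by
counting dimensions. -/
theorem exists_weakRx (hM : ∀ j, (L.d0 d j : ℤ) ≤ L.Me j) (H : Channel M N) :
    ∃ Sr : L.RxFrames, WeakRx H Sr := by
  have h : ∀ j, ∃ W : Matrix (Fin (L.Ms j)) (Fin (L.me j)) ℂ, Wᴴ * W = 1 ∧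
      Wᴴ * L.concatII H j = 0 := fun j => by
    refine (rank_add_le_iff (L.concatII H j)).1 ?_
    have h1 := (L.concatII H j).rank_le_card_width
    have h2 := card_concatII hM j
    rw [Fintype.card_fin]
    omega
  choose Sr h1 h2 using h
  exact ⟨Sr, h1, fun j => (mul_concatII_eq_zero_iff _).1 (h2 j)⟩

theorem exists_weakTx (hM : ∀ j, (L.d0 d j : ℤ) ≤ L.Me j) (hN : ∀ i, (d i : ℤ) ≤ L.Ne i)
    (H : Channel M N) (Sr : L.RxFrames) : ∃ St : L.TxFrames, WeakTx H Sr St := by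
  have h : ∀ i, ∃ W : Matrix (Fin (L.Ns i)) (Fin (L.ne i)) ℂ, Wᴴ * W = 1 ∧
      ∀ c, (fun r => W r c) ∈ nullSpace (L.stackIII H Sr i) := fun i => by
    refine exists_orthonormal_cols _ ?_
    have h1 := (L.stackIII H Sr i).rank_le_card_height
    have h2 := card_stackIII hM hN i
    have h3 := finrank_nullSpace_add_rank (L.stackIII H Sr i)
    rw [Fintype.card_fin] at h3
    omega
  choose St h1 h2 using h
  refine ⟨St, h1, fun j i hi => ?_⟩
  rw [← forall_col_mem_nullSpace]
  intro c
  have := h2 i c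
  rw [nullSpace_stackIII] at this
  exact (Submodule.mem_iInf _).1 this ⟨j, hi⟩

theorem IsRxFrames.weakRx {H : Channel M N} {Sr : L.RxFrames} (h : L.IsRxFrames H Sr) :
    WeakRx H Sr := by
  refine ⟨fun j => (h j).1, fun j => (mul_concatII_eq_zero_iff _).1 ?_⟩
  rw [← forall_col_mem_leftNullSpace]
  intro c
  rw [← (h j).2]
  exact col_mem_colSpan _ _

theorem WeakRx.isRxFrames {H : Channel M N} {Sr : L.RxFrames} (h : WeakRx H Sr)
    (hd : ∀ j, Module.finrank ℂ (leftNullSpace (L.concatII H j)) ≤ L.me j) :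
    L.IsRxFrames H Sr :=
  fun j => ⟨h.1 j, colSpan_eq_of_orthonormal (h.1 j)
    (forall_col_mem_leftNullSpace.2 ((mul_concatII_eq_zero_iff _).2 (h.2 j))) (by simpa using hd j)⟩

theorem IsRxFrames.finrank_le {H : Channel M N} {Sr : L.RxFrames} (h : L.IsRxFrames H Sr)
    (j : Fin K) : Module.finrank ℂ (leftNullSpace (L.concatII H j)) ≤ L.me j := by
  rw [← (h j).2, finrank_colSpan, rank_of_conjTranspose_mul_self (h j).1, Fintype.card_fin]

/-- Two choices of `S_j^r` differ by a change of basis. -/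
theorem IsRxFrames.exists_eq_mul {H : Channel M N} {Sr Sr' : L.RxFrames}
    (h : L.IsRxFrames H Sr) (h' : L.IsRxFrames H Sr') (j : Fin K) :
    ∃ C : Matrix (Fin (L.me j)) (Fin (L.me j)) ℂ, Sr' j = Sr j * C := by
  refine exists_eq_mul_of_col_mem fun c => ?_
  rw [(h j).2, ← (h' j).2]
  exact col_mem_colSpan _ _

theorem IsRxFrames.nullSpace_eq {H : Channel M N} {Sr Sr' : L.RxFrames}
    (h : L.IsRxFrames H Sr) (h' : L.IsRxFrames H Sr') (j i : Fin K) :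
    nullSpace ((Sr j)ᴴ * L.Hs H j i) = nullSpace ((Sr' j)ᴴ * L.Hs H j i) := by
  have key : ∀ {S S' : L.RxFrames}, L.IsRxFrames H S → L.IsRxFrames H S' →
      nullSpace ((S j)ᴴ * L.Hs H j i) ≤ nullSpace ((S' j)ᴴ * L.Hs H j i) := by
    intro S S' hS hS' v hv
    obtain ⟨C, hC⟩ := hS.exists_eq_mul hS' j
    rw [mem_nullSpace_iff] at hv ⊢
    rw [hC, Matrix.conjTranspose_mul, Matrix.mul_assoc, ← Matrix.mulVec_mulVec, hv,
      Matrix.mulVec_zero]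
  exact le_antisymm (key h h') (key h' h)

theorem WeakTx.isTxFrames {H : Channel M N} {Sr : L.RxFrames} {St : L.TxFrames}
    (h : WeakTx H Sr St)
    (hd : ∀ i, Module.finrank ℂ (nullSpace (L.stackIII H Sr i)) ≤ L.ne i) :
    L.IsTxFrames H Sr St := by
  intro i
  refine ⟨h.1 i, ?_⟩
  rw [← nullSpace_stackIII]
  refine colSpan_eq_of_orthonormal (h.1 i) (fun c => ?_) (by simpa using hd i)
  rw [nullSpace_stackIII, Submodule.mem_iInf]
  rintro ⟨j, hj⟩
  exact forall_col_mem_nullSpace.2 (h.2 j i hj) c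

/-- At a realization that admits frames, orthonormal columns in the null spaces in question span
these null spaces. -/
theorem IsFrames.of_weak {H : Channel M N} {Sr₀ Sr : L.RxFrames} {St₀ St : L.TxFrames}
    (h₀ : L.IsFrames H Sr₀ St₀) (hr : WeakRx H Sr) (ht : WeakTx H Sr St) :
    L.IsFrames H Sr St := by
  have hSr := hr.isRxFrames h₀.1.finrank_le
  refine ⟨hSr, ht.isTxFrames fun i => ?_⟩
  rw [nullSpace_stackIII]
  rw [show (⨅ j : {j // i ∈ L.ΩIII j}, nullSpace ((Sr j)ᴴ * L.Hs H j i)) =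
      ⨅ j : {j // i ∈ L.ΩIII j}, nullSpace ((Sr₀ j)ᴴ * L.Hs H j i) from
    iInf_congr fun j => hSr.nullSpace_eq h₀.1 j i, ← (h₀.2 i).2, finrank_colSpan,
    rank_of_conjTranspose_mul_self (h₀.2 i).1, Fintype.card_fin]

/-! ### Channels with prescribed submatrices -/

/-- The channel with the given submatrices `H_{ji}^s` and zeros elsewhere. -/
def ofHs (L : Profile M N) (A : ∀ j i : Fin K, Matrix (Fin (L.Ms j)) (Fin (L.Ns i)) ℂ) :
    Channel M N :=
  fun j i a b => if h : (a : ℕ) < L.Ms j ∧ (b : ℕ) < L.Ns i then A j i ⟨a, h.1⟩ ⟨b, h.2⟩ else 0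

theorem Hs_ofHs (A : ∀ j i : Fin K, Matrix (Fin (L.Ms j)) (Fin (L.Ns i)) ℂ) (j i : Fin K) :
    L.Hs (L.ofHs A) j i = A j i := by
  ext a b
  simp [Hs, ofHs, firstIdx]

theorem Hs_mix_of_mem {A : Fin K → Finset (Fin K)} {H H' : Channel M N} {j i : Fin K}
    (h : i ∈ A j) : L.Hs (mix A H H') j i = L.Hs H j i := by
  simp [Hs, mix, h]

theorem Hs_mix_of_notMem {A : Fin K → Finset (Fin K)} {H H' : Channel M N} {j i : Fin K}
    (h : i ∉ A j) : L.Hs (mix A H H') j i = L.Hs H' j i := by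
  simp [Hs, mix, h]

@[fun_prop]
theorem continuous_Hs (j i : Fin K) : Continuous fun H : Channel M N => L.Hs H j i := by
  refine continuous_matrix fun a b => ?_
  simp only [Hs, Matrix.submatrix_apply, Matrix.of_apply]
  fun_prop

theorem differentiable_Hs (j i : Fin K) (a : Fin (L.Ms j)) (b : Fin (L.Ns i)) :
    Differentiable ℂ fun H : Channel M N => L.Hs H j i a b := by
  simp only [Hs, Matrix.submatrix_apply, Matrix.of_apply]
  fun_prop

/-! ### Frames exist almost surely -/

theorem ae_finrank_leftNullSpace_le (hM : ∀ j, (L.d0 d j : ℤ) ≤ L.Me j) :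
    ∀ᵐ H ∂channelLaw M N, ∀ j,
      Module.finrank ℂ (leftNullSpace (L.concatII H j)) ≤ L.me j := by
  rw [ae_all_iff]
  intro j
  obtain ⟨C, hC⟩ := exists_isometry_of_card_le
    (m := Fin (L.Ms j)) (n := Σ i : {i // i ∈ L.ΩII j}, Fin (L.Ns i))
    (by have := card_concatII hM j; rw [Fintype.card_fin]; omega)
  have h := holoGeneric_channelLaw M N (fun H => (Cᴴ * L.concatII H j).det)
    (differentiable_det fun a b => differentiable_mul_apply (fun _ _ => by fun_prop)
      (fun a b => differentiable_Hs _ _ _ _) a b)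
    ⟨L.ofHs fun j' i => Matrix.of fun a b =>
        if h : j' = j ∧ i ∈ L.ΩII j then C (h.1 ▸ a) ⟨⟨i, h.2⟩, b⟩ else 0, by
      have : L.concatII (L.ofHs fun j' i => Matrix.of fun a b =>
          if h : j' = j ∧ i ∈ L.ΩII j then C (h.1 ▸ a) ⟨⟨i, h.2⟩, b⟩ else 0) j = C := by
        ext a ⟨⟨i, hi⟩, b⟩
        simp [concatII, Hs_ofHs]
      rw [this, hC]; simp⟩
  filter_upwards [h] with H hH
  have h1 := card_le_rank_of_mul_det_ne_zero _ _ hH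
  have h2 := finrank_leftNullSpace_add_rank (L.concatII H j)
  have h3 := card_concatII hM j
  rw [Fintype.card_fin] at h2
  omega

theorem differentiable_stackIII (Sr : L.RxFrames) (i : Fin K) (r c) :
    Differentiable ℂ fun H : Channel M N => L.stackIII H Sr i r c :=
  differentiable_mul_apply (A := fun _ => (Sr r.1)ᴴ) (B := fun H => L.Hs H r.1 i)
    (fun _ _ => differentiable_const _) (fun a b => differentiable_Hs r.1 i a b) r.2 c

theorem differentiable_det_stackIII (Sr : L.RxFrames) (i : Fin K)
    (E : Matrix (Fin (L.Ns i)) (Σ j : {j // i ∈ L.ΩIII j}, Fin (L.me j)) ℂ) :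
    Differentiable ℂ fun H : Channel M N => (L.stackIII H Sr i * E).det :=
  differentiable_det fun a b => differentiable_mul_apply
    (fun r c => differentiable_stackIII Sr i r c) (fun r c => differentiable_const (E r c)) a b

theorem continuous_det_stackIII {X : Type*} [TopologicalSpace X] {H : X → Channel M N}
    {Sr : X → L.RxFrames} (hH : Continuous H) (hSr : Continuous Sr) (i : Fin K)
    (E : Matrix (Fin (L.Ns i)) (Σ j : {j // i ∈ L.ΩIII j}, Fin (L.me j)) ℂ) :
    Continuous fun x => (L.stackIII (H x) (Sr x) i * E).det := by
  refine Continuous.matrix_det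
    (Continuous.matrix_mul (continuous_matrix fun r c => ?_) continuous_const)
  exact Continuous.matrix_elem
    (A := fun x => (Sr x r.1)ᴴ * L.Hs (H x) r.1 i) (by fun_prop) _ _

/-- Given `S_j^r`, the strategy III links can be chosen such that the `(S_j^r)† H_{ji}^s` take
prescribed values. -/
theorem exists_stackIII_mix_eq {Sr : L.RxFrames} (hSr : ∀ j, (Sr j)ᴴ * Sr j = 1)
    (E : ∀ i, Matrix (Σ j : {j // i ∈ L.ΩIII j}, Fin (L.me j)) (Fin (L.Ns i)) ℂ)
    (H : Channel M N) : ∃ H', ∀ i, L.stackIII (mix L.ΩII H H') Sr i = E i := by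
  refine ⟨L.ofHs fun j i => if h : i ∈ L.ΩIII j then
    Sr j * (E i).submatrix (fun a => ⟨⟨j, h⟩, a⟩) id else 0, fun i => ?_⟩
  ext ⟨⟨j, hj⟩, a⟩ b
  have hj' : i ∉ L.ΩII j := fun h => Finset.disjoint_left.1 (L.disj_II_III j) h hj
  simp only [stackIII, Matrix.of_apply]
  rw [Hs_mix_of_notMem hj', Hs_ofHs, dif_pos hj, ← Matrix.mul_assoc, hSr, Matrix.one_mul]
  rfl

/-- For almost every channel all null spaces have their generic dimension, so that the prescribed
frames exist. -/
theorem ae_exists_isFrames (hM : ∀ j, (L.d0 d j : ℤ) ≤ L.Me j) (hN : ∀ i, (d i : ℤ) ≤ L.Ne i) :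
    ∀ᵐ H ∂channelLaw M N, ∃ Sr St, L.IsFrames H Sr St := by
  have hE : ∀ i, ∃ E : Matrix (Fin (L.Ns i)) (Σ j : {j // i ∈ L.ΩIII j}, Fin (L.me j)) ℂ,
      Eᴴ * E = 1 := fun i => exists_isometry_of_card_le (by
    have := card_stackIII hM hN i
    rw [Fintype.card_fin]; omega)
  choose E hE using hE
  have hclosed : IsClosed {p : (Channel M N × Unit) × L.RxFrames |
      ∀ j, ∀ i ∈ L.ΩII j, (p.2 j)ᴴ * L.Hs p.1.1 j i = 0} := by
    simp only [Set.ofPred_forall]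
    refine isClosed_iInter fun j => isClosed_iInter fun i => isClosed_iInter fun _ => ?_
    exact isClosed_eq (by fun_prop) (by fun_prop)
  have hcont : Continuous fun p : (Channel M N × Unit) × L.RxFrames =>
      ∏ i, (L.stackIII p.1.1 p.2 i * E i).det := by
    refine continuous_finsetProd _ fun i _ => ?_
    exact continuous_det_stackIII (H := fun p : (Channel M N × Unit) × L.RxFrames => p.1.1)
      (Sr := fun p => p.2) (by fun_prop) (by fun_prop) i (E i)
  have hdiff : ∀ Sr : L.RxFrames, Differentiable ℂ fun H : Channel M N =>
      ∏ i, (L.stackIII H Sr i * E i).det := fun Sr => by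
    have h := fun i => differentiable_det_stackIII Sr i (E i)
    fun_prop
  have key := ae_exists_of_mix (M := M) (N := N) L.ΩII (T := Unit) (Y := L.RxFrames)
    (s := fun _ => ()) measurable_const (.of_forall fun _ _ => rfl)
    (isCompact_pi_stiefel (fun j => Fin (L.Ms j)) (fun j => Fin (L.me j)))
    hclosed hcont (fun _ y => hdiff y)
    (.of_forall fun H => by
      obtain ⟨Sr, hSr⟩ := exists_weakRx hM H
      obtain ⟨H', hH'⟩ := exists_stackIII_mix_eq hSr.1 (fun i => (E i)ᴴ) H
      refine ⟨Sr, hSr.1, fun H' j i hi => ?_, H', ?_⟩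
      · have := hSr.2 j i hi
        rwa [← Hs_mix_of_mem (A := L.ΩII) (H' := H') hi] at this
      · refine Finset.prod_ne_zero_iff.2 fun i _ => ?_
        simp only [hH', hE, Matrix.det_one]
        exact one_ne_zero)
  filter_upwards [key, ae_finrank_leftNullSpace_le hM] with H ⟨Sr, hSr, hII, hdet⟩ hrank
  obtain ⟨St, hSt⟩ := exists_weakTx hM hN H Sr
  refine ⟨Sr, St, WeakRx.isRxFrames ⟨hSr, hII⟩ hrank, hSt.isTxFrames fun i => ?_⟩
  have h0 := Finset.prod_ne_zero_iff.1 hdet i (Finset.mem_univ i)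
  have h1 : Fintype.card (Σ j : {j // i ∈ L.ΩIII j}, Fin (L.me j)) ≤ (L.stackIII H Sr i).rank := by
    rw [← Matrix.rank_of_isUnit (L.stackIII H Sr i * E i)
      ((Matrix.isUnit_iff_isUnit_det _).2 h0.isUnit)]
    exact Matrix.rank_mul_le_left _ _
  have h2 := finrank_nullSpace_add_rank (L.stackIII H Sr i)
  have h3 := card_stackIII hM hN i
  rw [Fintype.card_fin] at h2
  omega

/-! ### Independence is generic -/

theorem Xall_congr (hM : ∀ j, (L.d0 d j : ℤ) ≤ L.Me j) (hN : ∀ i, (d i : ℤ) ≤ L.Ne i)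
    {G G' : L.GFamily} (h : ∀ j, ∀ i ∈ L.ΩIV j, G j i = G' j i) :
    Xall hM hN G = Xall hM hN G' := by
  ext ⟨⟨j, ⟨i, hi⟩⟩, r⟩ c
  simp only [Xall, Matrix.of_apply, X, G2, G3, h j i hi]

theorem continuous_Xall {E : Type*} [TopologicalSpace E]
    (hM : ∀ j, (L.d0 d j : ℤ) ≤ L.Me j) (hN : ∀ i, (d i : ℤ) ≤ L.Ne i) {G : E → L.GFamily}
    (hG : Continuous G) : Continuous fun x => Xall hM hN (G x) := by
  have hG' : ∀ j i a b, Continuous fun x => G x j i a b := fun j i a b =>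
    Continuous.matrix_elem (A := fun x => G x j i) (by fun_prop) a b
  refine continuous_matrix fun r c => ?_
  obtain ⟨⟨j, i⟩, k, l⟩ := r
  rcases c with ⟨p, t, l'⟩ | ⟨p, k', s⟩
  · by_cases hp : p = j
    · subst hp
      simp only [Xall, X, Matrix.of_apply, dite_true, Matrix.kroneckerMap_apply,
        Matrix.transpose_apply, G2, Matrix.submatrix_apply]
      exact (hG' _ _ _ _).mul continuous_const
    · simpa [Xall, X, hp] using continuous_const
  · by_cases hp : p = i
    · subst hp
      simp only [Xall, X, Matrix.of_apply, dite_true, Matrix.kroneckerMap_apply,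
        G3, Matrix.submatrix_apply]
      exact continuous_const.mul (hG' _ _ _ _)
    · simpa [Xall, X, hp] using continuous_const

theorem differentiable_G (Sr : L.RxFrames) (St : L.TxFrames)
    (R : ∀ j : Fin K, Matrix (Fin (L.me j)) (Fin (L.me j)) ℂ) (j i : Fin K) (a b) :
    Differentiable ℂ fun H : Channel M N => L.G H Sr St R j i a b :=
  differentiable_mul_apply (fun a b => differentiable_mul_apply (fun _ _ => by fun_prop)
    (fun _ _ => differentiable_Hs _ _ _ _) a b) (fun _ _ => by fun_prop) a b

theorem differentiable_det_Xall_G (hM : ∀ j, (L.d0 d j : ℤ) ≤ L.Me j)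
    (hN : ∀ i, (d i : ℤ) ≤ L.Ne i) (Sr : L.RxFrames) (St : L.TxFrames)
    (R : ∀ j : Fin K, Matrix (Fin (L.me j)) (Fin (L.me j)) ℂ)
    (Y : Matrix (L.Unknowns d) (L.Equations d) ℂ) :
    Differentiable ℂ fun H : Channel M N => (Xall hM hN (L.G H Sr St R) * Y).det :=
  differentiable_det fun a b => differentiable_mul_apply
    (fun r c => differentiable_Xall hM hN (fun j i a b => differentiable_G Sr St R j i a b) r c)
    (fun r c => differentiable_const (Y r c)) a b

theorem continuous_det_Xall_G {E : Type*} [TopologicalSpace E]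
    (hM : ∀ j, (L.d0 d j : ℤ) ≤ L.Me j) (hN : ∀ i, (d i : ℤ) ≤ L.Ne i) {H : E → Channel M N}
    {Sr : E → L.RxFrames} {St : E → L.TxFrames} (hH : Continuous H) (hSr : Continuous Sr)
    (hSt : Continuous St) (R : ∀ j : Fin K, Matrix (Fin (L.me j)) (Fin (L.me j)) ℂ)
    (Y : Matrix (L.Unknowns d) (L.Equations d) ℂ) :
    Continuous fun x => (Xall hM hN (L.G (H x) (Sr x) (St x) R) * Y).det := by
  have hG : Continuous fun x => L.G (H x) (Sr x) (St x) R := by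
    refine continuous_pi fun j => continuous_pi fun i => ?_
    unfold G
    fun_prop
  exact ((continuous_Xall hM hN hG).matrix_mul continuous_const).matrix_det

/-- Given the frames, the strategy IV links can be chosen such that their matrices `G_{ji}` take
prescribed values; `Xall` depends on no others. -/
theorem exists_Xall_mix_eq (hM : ∀ j, (L.d0 d j : ℤ) ≤ L.Me j) (hN : ∀ i, (d i : ℤ) ≤ L.Ne i)
    {Sr : L.RxFrames} {St : L.TxFrames} (hSr : ∀ j, (Sr j)ᴴ * Sr j = 1)
    (hSt : ∀ i, (St i)ᴴ * St i = 1) (G₀ : L.GFamily) (H : Channel M N) :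
    ∃ H', Xall hM hN (L.G (mix (fun j => L.ΩII j ∪ L.ΩIII j) H H') Sr St fun _ => 1) =
      Xall hM hN G₀ := by
  refine ⟨L.ofHs fun j i => Sr j * G₀ j i * (St i)ᴴ, Xall_congr hM hN fun j i hi => ?_⟩
  have hi' : i ∉ L.ΩII j ∪ L.ΩIII j := by
    rw [Finset.mem_union, not_or]
    exact ⟨fun h => Finset.disjoint_left.1 (L.disj_II_IV j) h hi,
      fun h => Finset.disjoint_left.1 (L.disj_III_IV j) h hi⟩
  rw [G, Hs_mix_of_notMem hi', Hs_ofHs, Matrix.one_mul, Matrix.mul_assoc, Matrix.mul_assoc,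
    Matrix.mul_assoc, hSt, Matrix.mul_one, ← Matrix.mul_assoc, hSr, Matrix.one_mul]

/-- Independence at one family `G₀`, whether or not it comes from a channel, gives independence at
almost every channel: for fixed frames, the strategy IV links can realize `G₀`. -/
theorem ae_independentAt (hM : ∀ j, (L.d0 d j : ℤ) ≤ L.Me j) (hN : ∀ i, (d i : ℤ) ≤ L.Ne i)
    {G₀ : L.GFamily} (h₀ : RowsIndependent hM hN G₀) :
    ∀ᵐ H ∂channelLaw M N, IndependentAt hM hN H := by
  obtain ⟨Y, hY⟩ := rowsIndependent_iff.1 h₀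
  have key := ae_exists_of_mix (M := M) (N := N) (fun j => L.ΩII j ∪ L.ΩIII j) (T := Unit)
    (Y := L.RxFrames × L.TxFrames)
    (s := fun _ => ()) measurable_const (.of_forall fun _ _ => rfl)
    ((isCompact_pi_stiefel (fun j => Fin (L.Ms j)) (fun j => Fin (L.me j))).prod
      (isCompact_pi_stiefel (fun j => Fin (L.Ns j)) (fun j => Fin (L.ne j))))
    (C := {p | (∀ j, ∀ i ∈ L.ΩII j, (p.2.1 j)ᴴ * L.Hs p.1.1 j i = 0) ∧
      ∀ j, ∀ i ∈ L.ΩIII j, (p.2.1 j)ᴴ * L.Hs p.1.1 j i * p.2.2 i = 0}) (by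
      simp only [Set.ofPred_and, Set.ofPred_forall]
      refine IsClosed.inter ?_ ?_ <;>
      · refine isClosed_iInter fun j => isClosed_iInter fun i => isClosed_iInter fun _ => ?_
        exact isClosed_eq (by fun_prop) (by fun_prop))
    (g := fun p => (Xall hM hN (L.G p.1.1 p.2.1 p.2.2 fun _ => 1) * Y).det)
    (continuous_det_Xall_G hM hN (by fun_prop) (by fun_prop) (by fun_prop) _ Y)
    (fun t y => differentiable_det_Xall_G hM hN y.1 y.2 _ Y)
    (.of_forall fun H => by
      obtain ⟨Sr, hSr⟩ := exists_weakRx hM H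
      obtain ⟨St, hSt⟩ := exists_weakTx hM hN H Sr
      obtain ⟨H', hH'⟩ := exists_Xall_mix_eq hM hN hSr.1 hSt.1 G₀ H
      refine ⟨(Sr, St), ⟨hSr.1, hSt.1⟩, fun H' => ⟨fun j i hi => ?_, fun j i hi => ?_⟩, H', ?_⟩
      · have := hSr.2 j i hi
        rwa [← Hs_mix_of_mem (A := fun j => L.ΩII j ∪ L.ΩIII j) (H' := H')
          (Finset.mem_union_left _ hi)] at this
      · have := hSt.2 j i hi
        rwa [← Hs_mix_of_mem (A := fun j => L.ΩII j ∪ L.ΩIII j) (H' := H')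
          (Finset.mem_union_right _ hi)] at this
      · simpa only [hH'] using hY)
  filter_upwards [key, ae_exists_isFrames hM hN] with H ⟨⟨Sr, St⟩, ⟨hSr, hSt⟩, ⟨hII, hIII⟩, hdet⟩
    ⟨Sr₀, St₀, hfr⟩
  exact ⟨Sr, St, fun _ => 1, hfr.of_weak ⟨hSr, hII⟩ ⟨hSt, hIII⟩, fun _ => isUnit_one,
    rowsIndependent_iff.2 ⟨Y, hdet⟩⟩

/-- Pairs of families `(S_j^r)`, `(S_i^t)` as plain arrays, which carry a Borel structure. -/
abbrev FrameArrays (L : Profile M N) : Type :=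
  (∀ j, Fin (L.Ms j) → Fin (L.me j) → ℂ) × (∀ i, Fin (L.Ns i) → Fin (L.ne i) → ℂ)

theorem continuous_det_Xall_G_frameArrays (hM : ∀ j, (L.d0 d j : ℤ) ≤ L.Me j)
    (hN : ∀ i, (d i : ℤ) ≤ L.Ne i) (Y : Matrix (L.Unknowns d) (L.Equations d) ℂ) :
    Continuous fun p : (Channel M N × FrameArrays L) × Unit =>
      (Xall hM hN (L.G p.1.1 (fun j => Matrix.of (p.1.2.1 j))
        (fun i => Matrix.of (p.1.2.2 i)) fun _ => 1) * Y).det := by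
  have hSr : Continuous fun p : (Channel M N × FrameArrays L) × Unit =>
      (fun j => Matrix.of (p.1.2.1 j) : L.RxFrames) :=
    continuous_pi fun j => continuous_matrix fun a b => by simp only [Matrix.of_apply]; fun_prop
  have hSt : Continuous fun p : (Channel M N × FrameArrays L) × Unit =>
      (fun i => Matrix.of (p.1.2.2 i) : L.TxFrames) :=
    continuous_pi fun i => continuous_matrix fun a b => by simp only [Matrix.of_apply]; fun_prop
  have hH : Continuous fun p : (Channel M N × FrameArrays L) × Unit => p.1.1 := by fun_prop
  exact continuous_det_Xall_G hM hN hH hSr hSt _ Y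

/-- The values of a frame rule as plain arrays. -/
def FrameRule.arrays (S : L.FrameRule) (H : Channel M N) : FrameArrays L :=
  (fun j a b => S.Sr H j a b, fun i a b => S.St H i a b)

theorem FrameRule.measurable_arrays (S : L.FrameRule) : Measurable S.arrays :=
  Measurable.prodMk
    (measurable_pi_iff.2 fun j => measurable_pi_iff.2 fun a => measurable_pi_iff.2 fun b =>
      S.measurable_Sr j a b)
    (measurable_pi_iff.2 fun j => measurable_pi_iff.2 fun a => measurable_pi_iff.2 fun b =>
      S.measurable_St j a b)

theorem FrameRule.arrays_mix (S : L.FrameRule) (H H' : Channel M N) :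
    S.arrays (mix (fun j => L.ΩII j ∪ L.ΩIII j) H H') = S.arrays H := by
  obtain ⟨h1, h2⟩ := S.local_dep (mix (fun j => L.ΩII j ∪ L.ΩIII j) H H') H
    fun j i hi => by simp only [mix, hi, if_true]
  simp only [arrays, h1, h2]

/-- Frames computed from the strategy II and III links are independent of the strategy IV links,
which remain free to make the rows independent. -/
theorem FrameRule.ae_rowsIndependent (hM : ∀ j, (L.d0 d j : ℤ) ≤ L.Me j)
    (hN : ∀ i, (d i : ℤ) ≤ L.Ne i) {G₀ : L.GFamily} (h₀ : RowsIndependent hM hN G₀)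
    (S : L.FrameRule) :
    ∀ᵐ H ∂channelLaw M N, RowsIndependent hM hN (L.G H (S.Sr H) (S.St H) fun _ => 1) := by
  obtain ⟨Y, hY⟩ := rowsIndependent_iff.1 h₀
  have hne : ∀ᵐ H ∂channelLaw M N, ∃ H', (Xall hM hN (L.G
      (mix (fun j => L.ΩII j ∪ L.ΩIII j) H H') (S.Sr H) (S.St H) fun _ => 1) * Y).det ≠ 0 := by
    filter_upwards [S.isFrames] with H hH
    obtain ⟨H', hH'⟩ := exists_Xall_mix_eq hM hN (fun j => (hH.1 j).1) (fun i => (hH.2 i).1) G₀ H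
    exact ⟨H', by rwa [hH']⟩
  have hne' : ∀ᵐ H ∂channelLaw M N, ∃ y ∈ ({()} : Set Unit),
      (∀ H', ((mix (fun j => L.ΩII j ∪ L.ΩIII j) H H', S.arrays H), y) ∈
        (Set.univ : Set ((Channel M N × FrameArrays L) × Unit))) ∧
      ∃ H', (Xall hM hN (L.G (mix (fun j => L.ΩII j ∪ L.ΩIII j) H H')
        (fun j => Matrix.of ((S.arrays H).1 j)) (fun i => Matrix.of ((S.arrays H).2 i))
        fun _ => 1) * Y).det ≠ 0 :=
    hne.mono fun H hH => ⟨(), rfl, fun _ => trivial, hH⟩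
  have key := ae_exists_of_mix (M := M) (N := N) (fun j => L.ΩII j ∪ L.ΩIII j)
    (T := FrameArrays L)
    (Y := Unit) (s := S.arrays) S.measurable_arrays (.of_forall S.arrays_mix)
    (Q := {()}) isCompact_singleton (C := Set.univ) isClosed_univ
    (continuous_det_Xall_G_frameArrays hM hN Y)
    (fun t _ => differentiable_det_Xall_G hM hN (fun j => Matrix.of (t.1 j))
      (fun i => Matrix.of (t.2 i)) (fun _ => 1) Y) hne'
  filter_upwards [key] with H ⟨_, _, _, hdet⟩
  exact rowsIndependent_iff.2 ⟨Y, hdet⟩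

/-! ### Precoders from the feedback -/

/-- Families of matrices `W_i` of size `N_i^s × d_i`, as plain arrays; the precoders are these
matrices with zero rows appended. -/
abbrev Precoders (L : Profile M N) (d : Fin K → ℕ) : Type :=
  ∀ i : Fin K, Fin (L.Ns i) → Fin (d i) → ℂ

/-- Families of matrices of size `M_j^e × d_j^0`. -/
abbrev Filters (L : Profile M N) (d : Fin K → ℕ) : Type :=
  ∀ j : Fin K, Matrix (Fin (L.me j)) (Fin (L.d0 d j)) ℂ

/-- The equations satisfied by a channel `H`, precoders `W`, frames `S_j^r` and interference filters
`U_j`: the links of strategies II, III and IV are cancelled by `S_j^r`, `W` and `U_j`. -/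
def CancelsAt (H : Channel M N) (W : L.Precoders d) (Sr : L.RxFrames) (U : L.Filters d) : Prop :=
  (∀ j, ∀ i ∈ L.ΩII j, (Sr j)ᴴ * L.Hs H j i = 0) ∧
  (∀ j, ∀ i ∈ L.ΩIII j, (Sr j)ᴴ * L.Hs H j i * Matrix.of (W i) = 0) ∧
  ∀ j, ∀ i ∈ L.ΩIV j, (U j)ᴴ * ((Sr j)ᴴ * L.Hs H j i) * Matrix.of (W i) = 0

/-- The pairs (frames, filters) with orthonormal columns. -/
def orthonormalFrameFilters (L : Profile M N) (d : Fin K → ℕ) : Set (L.RxFrames × L.Filters d) :=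
  {Sr : L.RxFrames | ∀ j, (Sr j)ᴴ * Sr j = 1} ×ˢ {U : L.Filters d | ∀ j, (U j)ᴴ * U j = 1}

/-- `W` is an orthonormal solution of the alignment problem for the links of strategies II,
III and IV. -/
def IsPrecoder (H : Channel M N) (W : L.Precoders d) : Prop :=
  (∀ i, (Matrix.of (W i))ᴴ * Matrix.of (W i) = 1) ∧
    ∃ y ∈ orthonormalFrameFilters L d, CancelsAt H W y.1 y.2

theorem isCompact_orthonormalFrameFilters : IsCompact (orthonormalFrameFilters L d) :=
  (isCompact_pi_stiefel (fun j => Fin (L.Ms j)) (fun j => Fin (L.me j))).prod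
    (isCompact_pi_stiefel (fun j => Fin (L.me j)) (fun j => Fin (L.d0 d j)))

theorem continuous_of_precoder {X : Type*} [TopologicalSpace X] {W : X → L.Precoders d}
    (hW : Continuous W) (i : Fin K) : Continuous fun x => Matrix.of (W x i) :=
  continuous_matrix fun a b => by simp only [Matrix.of_apply]; fun_prop

theorem isClosed_cancelsAt : IsClosed
    {p : (Channel M N × L.Precoders d) × (L.RxFrames × L.Filters d) |
      CancelsAt p.1.1 p.1.2 p.2.1 p.2.2} := by
  have hW : ∀ i, Continuous fun p : (Channel M N × L.Precoders d) × (L.RxFrames × L.Filters d) =>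
      Matrix.of (p.1.2 i) := continuous_of_precoder (by fun_prop)
  simp only [CancelsAt, Set.ofPred_and, Set.ofPred_forall]
  refine IsClosed.inter ?_ (IsClosed.inter ?_ ?_) <;>
  · refine isClosed_iInter fun j => isClosed_iInter fun i => isClosed_iInter fun _ => ?_
    have := hW i
    exact isClosed_eq (by fun_prop) (by fun_prop)

theorem isClosed_isPrecoder :
    IsClosed {p : Channel M N × L.Precoders d | IsPrecoder p.1 p.2} := by
  have hW : ∀ i, Continuous fun p : Channel M N × L.Precoders d => Matrix.of (p.2 i) :=
    continuous_of_precoder (by fun_prop)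
  have h1 : IsClosed {p : Channel M N × L.Precoders d |
      ∀ i, (Matrix.of (p.2 i))ᴴ * Matrix.of (p.2 i) = 1} := by
    simp only [Set.ofPred_forall]
    refine isClosed_iInter fun i => ?_
    have := hW i
    exact isClosed_eq (by fun_prop) (by fun_prop)
  exact h1.inter (isClosed_exists_mem_compact isCompact_orthonormalFrameFilters isClosed_cancelsAt)

theorem isCompact_orthonormalPrecoders :
    IsCompact {W : L.Precoders d | ∀ i, (Matrix.of (W i))ᴴ * Matrix.of (W i) = 1} :=
  isCompact_pi_stiefel (fun i => Fin (L.Ns i)) (fun i => Fin (d i))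

theorem CancelsAt.congr {H H' : Channel M N} {W : L.Precoders d} {Sr : L.RxFrames}
    {U : L.Filters d} (h : CancelsAt H W Sr U)
    (hH : ∀ j, ∀ i ∈ L.ΩII j ∪ L.ΩIII j ∪ L.ΩIV j, L.Hs H j i = L.Hs H' j i) :
    CancelsAt H' W Sr U := by
  refine ⟨fun j i hi => ?_, fun j i hi => ?_, fun j i hi => ?_⟩
  · rw [← hH j i (by simp [hi])]; exact h.1 j i hi
  · rw [← hH j i (by simp [hi])]; exact h.2.1 j i hi
  · rw [← hH j i (by simp [hi])]; exact h.2.2 j i hi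

theorem IsPrecoder.congr {H H' : Channel M N} {W : L.Precoders d} (h : IsPrecoder H W)
    (hH : ∀ j, ∀ i ∈ L.ΩII j ∪ L.ΩIII j ∪ L.ΩIV j, L.Hs H j i = L.Hs H' j i) :
    IsPrecoder H' W := by
  obtain ⟨hW, y, hy, hc⟩ := h
  exact ⟨hW, y, hy, hc.congr hH⟩

/-- Precoders that align the strategy IV links exist for every channel, degenerate ones included. -/
theorem exists_isPrecoder (hM : ∀ j, (L.d0 d j : ℤ) ≤ L.Me j) (hN : ∀ i, (d i : ℤ) ≤ L.Ne i)
    (hA : ∀ G : L.GFamily, AlignableIV d G) (H : Channel M N) :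
    ∃ W : L.Precoders d, IsPrecoder H W := by
  obtain ⟨Sr, hSr⟩ := exists_weakRx hM H
  obtain ⟨St, hSt⟩ := exists_weakTx hM hN H Sr
  obtain ⟨Va, Ua, hVa, hUa, hG⟩ := hA (fun j i => (Sr j)ᴴ * L.Hs H j i * St i)
  refine ⟨fun i => St i * Va i, fun i => ?_, (Sr, Ua), ⟨hSr.1, hUa⟩, hSr.2, fun j i hi => ?_,
    fun j i hi => ?_⟩
  · change (St i * Va i)ᴴ * (St i * Va i) = 1
    rw [Matrix.conjTranspose_mul, Matrix.mul_assoc, ← Matrix.mul_assoc (St i)ᴴ, hSt.1,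
      Matrix.one_mul, hVa]
  · change (Sr j)ᴴ * L.Hs H j i * (St i * Va i) = 0
    rw [← Matrix.mul_assoc, hSt.2 j i hi, Matrix.zero_mul]
  · change (Ua j)ᴴ * ((Sr j)ᴴ * L.Hs H j i) * (St i * Va i) = 0
    rw [← Matrix.mul_assoc, Matrix.mul_assoc (Ua j)ᴴ]
    exact hG j i hi

/-- A filter cancels `[⋯ (S_j^r)† H_{jq}^s ⋯] diag(W_q)` if and only if it cancels each strategy IV
link. -/
theorem mul_concatIV_blockDiagonal_eq_zero_iff {H : Channel M N} {Sr : L.RxFrames}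
    {W : L.Precoders d} {j : Fin K} {k : Type*} (A : Matrix k (Fin (L.me j)) ℂ) :
    A * (L.concatIV H Sr j *
        Matrix.blockDiagonal' fun q : {q // q ∈ L.ΩIV j} => Matrix.of (W q)) = 0 ↔
      ∀ i ∈ L.ΩIV j, A * ((Sr j)ᴴ * L.Hs H j i) * Matrix.of (W i) = 0 := by
  have key : ∀ (i : {q // q ∈ L.ΩIV j}) (r : Fin (L.me j)) (c : Fin (d i)),
      (L.concatIV H Sr j * Matrix.blockDiagonal' fun q : {q // q ∈ L.ΩIV j} => Matrix.of (W q))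
        r ⟨i, c⟩ = ((Sr j)ᴴ * L.Hs H j i * Matrix.of (W i)) r c := by
    intro i r c
    rw [Matrix.mul_apply, Fintype.sum_sigma, Matrix.mul_apply,
      Finset.sum_eq_single i (fun q _ hq => by
        refine Finset.sum_eq_zero fun x _ => ?_
        rw [Matrix.blockDiagonal'_apply_ne _ _ _ hq, mul_zero]) (by simp)]
    refine Finset.sum_congr rfl fun x _ => ?_
    rw [Matrix.blockDiagonal'_apply_eq]
    rfl
  constructor
  · intro h i hi
    ext a c
    have h1 := congrFun (congrFun h a) ⟨⟨i, hi⟩, c⟩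
    rw [Matrix.mul_apply] at h1
    simp only [key] at h1
    rw [Matrix.mul_assoc, Matrix.mul_apply]
    exact h1
  · intro h
    ext a ⟨⟨i, hi⟩, c⟩
    have h1 := congrFun (congrFun (h i hi) a) c
    rw [Matrix.mul_assoc, Matrix.mul_apply] at h1
    rw [Matrix.mul_apply]
    simp only [key]
    exact h1

/-- Whether `W` is a precoder can be decided from the feedback: the strategy IV links of Rx `j` can
be cancelled if and only if the image of the fed back row space has dimension at
most `M_j^e - d_j^0`. -/
theorem isPrecoder_iff_feedback {H : Channel M N} {Sr : L.RxFrames} (hSr : L.IsRxFrames H Sr)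
    (W : L.Precoders d) :
    IsPrecoder H W ↔ (∀ i, (Matrix.of (W i))ᴴ * Matrix.of (W i) = 1) ∧
      (∀ j (p : {p // p ∈ L.ΩIII j}) c, (fun r => W p r c) ∈ (L.feedback H Sr j).1 p) ∧
      ∀ j, Module.finrank ℂ ((L.feedback H Sr j).2.map (Matrix.blockDiagonal'
        fun q : {q // q ∈ L.ΩIV j} => Matrix.of (W q))ᵀ.mulVecLin) + L.d0 d j ≤ L.me j := by
  have hIV : ∀ (S : L.RxFrames) (j : Fin K),
      (L.concatIV H S j * Matrix.blockDiagonal'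
          fun q : {q // q ∈ L.ΩIV j} => Matrix.of (W q)).rank + L.d0 d j ≤ L.me j ↔
        ∃ U : Matrix (Fin (L.me j)) (Fin (L.d0 d j)) ℂ, Uᴴ * U = 1 ∧
          ∀ i ∈ L.ΩIV j, Uᴴ * ((S j)ᴴ * L.Hs H j i) * Matrix.of (W i) = 0 := by
    intro S j
    have h := rank_add_le_iff (k := L.d0 d j) (L.concatIV H S j * Matrix.blockDiagonal'
      fun q : {q // q ∈ L.ΩIV j} => Matrix.of (W q))
    rw [Fintype.card_fin] at h
    rw [h]
    simp only [mul_concatIV_blockDiagonal_eq_zero_iff]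
  have hfb : ∀ j, Module.finrank ℂ ((L.feedback H Sr j).2.map (Matrix.blockDiagonal'
        fun q : {q // q ∈ L.ΩIV j} => Matrix.of (W q))ᵀ.mulVecLin) =
      (L.concatIV H Sr j * Matrix.blockDiagonal'
        fun q : {q // q ∈ L.ΩIV j} => Matrix.of (W q)).rank :=
    fun j => (rank_mul_eq_finrank_map _ _).symm
  simp only [hfb]
  refine and_congr_right fun _ => ⟨?_, ?_⟩
  · rintro ⟨⟨S, U⟩, ⟨hS, hU⟩, hII, hIII, hIV'⟩
    have hS' : L.IsRxFrames H S := WeakRx.isRxFrames ⟨hS, hII⟩ hSr.finrank_le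
    refine ⟨fun j p c => ?_, fun j => ?_⟩
    · have h1 := forall_col_mem_nullSpace.2 (hIII j p p.2) c
      rw [hS'.nullSpace_eq hSr] at h1
      exact h1
    · obtain ⟨C, hC⟩ := hS'.exists_eq_mul hSr j
      have h1 : L.concatIV H Sr j = Cᴴ * L.concatIV H S j := by
        ext a ⟨q, b⟩
        simp only [concatIV, Matrix.of_apply, hC, Matrix.conjTranspose_mul, Matrix.mul_assoc]
        rw [Matrix.mul_apply, Matrix.mul_apply]
        rfl
      have h2 := (hIV S j).2 ⟨U j, hU j, hIV' j⟩
      rw [h1, Matrix.mul_assoc]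
      exact (Nat.add_le_add_right (Matrix.rank_mul_le_right _ _) _).trans h2
  · rintro ⟨hIII, hrank⟩
    choose U hU hU' using fun j => (hIV Sr j).1 (hrank j)
    exact ⟨(Sr, U), ⟨fun j => (hSr j).1, hU⟩, hSr.weakRx.2,
      fun j i hi => forall_col_mem_nullSpace.1 (hIII j ⟨i, hi⟩), hU'⟩

/-! ### Separation of the streams -/

/-- The received desired streams and strategy I streams of Rx `j`. -/
abbrev Streams (L : Profile M N) (d : Fin K → ℕ) (j : Fin K) : Type :=
  Fin (d j) ⊕ (Σ i : {i // i ∈ L.ΩI j}, Fin (d i))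

theorem card_streams (j : Fin K) :
    Fintype.card (L.Streams d j) = Fintype.card (Fin (L.d0 d j)) := by
  rw [Fintype.card_sum, Fintype.card_sigma, Fintype.card_fin, Fintype.card_fin, d0,
    ← Finset.sum_coe_sort (L.ΩI j)]
  simp

/-- A numbering of the streams; its choice is immaterial. -/
noncomputable def streamEquiv (L : Profile M N) (d : Fin K → ℕ) (j : Fin K) :
    L.Streams d j ≃ Fin (L.d0 d j) :=
  Fintype.equivOfCardEq (card_streams j)

/-- The transmitter of a stream. -/
def streamTx (j : Fin K) : L.Streams d j → Fin K :=
  Sum.elim (fun _ => j) fun c => c.1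

/-- The position of a stream among the streams of its transmitter. -/
def streamIdx (j : Fin K) : (c : L.Streams d j) → Fin (d (streamTx j c))
  | Sum.inl k => k
  | Sum.inr c => c.2

/-- The square matrix of the desired streams and strategy I streams at the output of the filter
`S_j^r U_j`. -/
noncomputable def streamMatrix (H : Channel M N) (W : L.Precoders d) (Sr : L.RxFrames)
    (U : L.Filters d) (j : Fin K) : Matrix (L.Streams d j) (L.Streams d j) ℂ :=
  Matrix.of fun r c => ((U j)ᴴ * (Sr j)ᴴ * L.Hs H j (streamTx j c) * Matrix.of (W (streamTx j c)))
    (streamEquiv L d j r) (streamIdx j c)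

theorem continuous_det_streamMatrix : Continuous
    fun p : (Channel M N × L.Precoders d) × (L.RxFrames × L.Filters d) =>
      ∏ j, (streamMatrix p.1.1 p.1.2 p.2.1 p.2.2 j).det := by
  refine continuous_finsetProd _ fun j _ => Continuous.matrix_det ?_
  refine continuous_matrix fun r c => ?_
  have hW : Continuous fun p : (Channel M N × L.Precoders d) × (L.RxFrames × L.Filters d) =>
      Matrix.of (p.1.2 (streamTx j c)) := continuous_of_precoder (by fun_prop) _
  exact Continuous.matrix_elem
    (A := fun p : (Channel M N × L.Precoders d) × (L.RxFrames × L.Filters d) =>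
      (p.2.2 j)ᴴ * (p.2.1 j)ᴴ * L.Hs p.1.1 j (streamTx j c) * Matrix.of (p.1.2 (streamTx j c)))
    (by fun_prop) _ _

theorem differentiable_streamMatrix (W : L.Precoders d) (Sr : L.RxFrames) (U : L.Filters d)
    (j : Fin K) (r c) : Differentiable ℂ fun H : Channel M N => streamMatrix H W Sr U j r c :=
  differentiable_mul_apply (A := fun H => (U j)ᴴ * (Sr j)ᴴ * L.Hs H j (streamTx j c))
    (B := fun _ => Matrix.of (W (streamTx j c)))
    (differentiable_mul_apply (A := fun _ => (U j)ᴴ * (Sr j)ᴴ)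
      (B := fun H => L.Hs H j (streamTx j c)) (fun _ _ => differentiable_const _)
      (fun a b => differentiable_Hs j _ a b))
    (fun _ _ => differentiable_const _) _ _

theorem differentiable_det_streamMatrix (W : L.Precoders d) (Sr : L.RxFrames) (U : L.Filters d) :
    Differentiable ℂ fun H : Channel M N => ∏ j, (streamMatrix H W Sr U j).det := by
  have h := fun j => differentiable_det (differentiable_streamMatrix W Sr U j)
  fun_prop

/-- The direct links and the strategy I links can be chosen such that the streams are received
without crosstalk. -/
theorem exists_streamMatrix_mix_eq_one {W : L.Precoders d} {Sr : L.RxFrames} {U : L.Filters d}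
    (hW : ∀ i, (Matrix.of (W i))ᴴ * Matrix.of (W i) = 1) (hSr : ∀ j, (Sr j)ᴴ * Sr j = 1)
    (hU : ∀ j, (U j)ᴴ * U j = 1) (H : Channel M N) :
    ∃ H', ∀ j, streamMatrix (mix (fun j => L.ΩII j ∪ L.ΩIII j ∪ L.ΩIV j) H H') W Sr U j = 1 := by
  classical
  let E : ∀ j i : Fin K, Matrix (Fin (L.d0 d j)) (Fin (d i)) ℂ := fun j i => Matrix.of fun r k =>
    if ∃ c : L.Streams d j, streamEquiv L d j c = r ∧ ∃ h : streamTx j c = i,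
      h ▸ streamIdx j c = k then 1 else 0
  refine ⟨L.ofHs fun j i => Sr j * U j * E j i * (Matrix.of (W i))ᴴ, fun j => ?_⟩
  ext r c
  have hmem : streamTx j c ∉ L.ΩII j ∪ L.ΩIII j ∪ L.ΩIV j := by
    rcases c with k | ⟨⟨i, hi⟩, k⟩
    · have : j ∉ L.ΩI j ∪ L.ΩII j ∪ L.ΩIII j ∪ L.ΩIV j := by rw [L.cover j]; simp
      simp only [Finset.mem_union, not_or] at this
      simp [streamTx, this]
    · have h1 := Finset.disjoint_left.1 (L.disj_I_II j) hi
      have h2 := Finset.disjoint_left.1 (L.disj_I_III j) hi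
      have h3 := Finset.disjoint_left.1 (L.disj_I_IV j) hi
      simp [streamTx, h1, h2, h3]
  have h1 : ∀ i, (U j)ᴴ * (Sr j)ᴴ * (Sr j * U j * E j i * (Matrix.of (W i))ᴴ) * Matrix.of (W i) =
      E j i := by
    intro i
    rw [Matrix.mul_assoc _ _ (Matrix.of (W i)), Matrix.mul_assoc _ (Matrix.of (W i))ᴴ, hW,
      Matrix.mul_one, Matrix.mul_assoc (U j)ᴴ, Matrix.mul_assoc (Sr j), ← Matrix.mul_assoc (Sr j)ᴴ,
      hSr, Matrix.one_mul, ← Matrix.mul_assoc, hU, Matrix.one_mul]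
  simp only [streamMatrix, Matrix.of_apply]
  rw [Hs_mix_of_notMem hmem, Hs_ofHs, h1, Matrix.one_apply]
  have h2 : (∃ c' : L.Streams d j, streamEquiv L d j c' = streamEquiv L d j r ∧
      ∃ h : streamTx j c' = streamTx j c, h ▸ streamIdx j c' = streamIdx j c) ↔ r = c := by
    constructor
    · rintro ⟨c', hc', h, hk⟩
      rw [(streamEquiv L d j).injective.eq_iff] at hc'
      subst hc'
      have hjj : j ∉ L.ΩI j := by
        have : j ∉ L.ΩI j ∪ L.ΩII j ∪ L.ΩIII j ∪ L.ΩIV j := by rw [L.cover j]; simp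
        simp only [Finset.mem_union, not_or] at this
        exact this.1.1.1
      rcases c' with k | ⟨⟨i, hi⟩, k⟩ <;> rcases c with k' | ⟨⟨i', hi'⟩, k'⟩
      · have hk' : k = k' := hk
        rw [hk']
      · exact absurd (show i' ∈ L.ΩI j from hi') (by
          have h' : j = i' := h
          rwa [← h'])
      · exact absurd (show i ∈ L.ΩI j from hi) (by
          have h' : i = j := h
          rwa [h'])
      · have h' : i = i' := h
        subst h'
        have hk' : k = k' := hk
        rw [hk']
    · rintro rfl
      exact ⟨r, rfl, rfl, rfl⟩
  simp only [E, Matrix.of_apply, h2]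

/-! ### Decorrelators and the solution of the alignment problem -/

/-- After cancelling the links of strategies II, III and IV, Rx `j` is left with as many
dimensions as there are desired and strategy I streams, and separates them by inverting their
matrix. -/
theorem CancelsAt.exists_decorrelator {H : Channel M N} {W : L.Precoders d} {Sr : L.RxFrames}
    {U : L.Filters d} (h : CancelsAt H W Sr U) {j : Fin K}
    (hdet : (streamMatrix H W Sr U j).det ≠ 0) :
    ∃ A : Matrix (Fin (L.me j)) (Fin (d j)) ℂ,
      (Sr j * A)ᴴ * L.Hs H j j * Matrix.of (W j) = 1 ∧
        ∀ i, i ≠ j → (Sr j * A)ᴴ * L.Hs H j i * Matrix.of (W i) = 0 := by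
  let Z := streamMatrix H W Sr U j
  let T : Matrix (Fin (d j)) (Fin (L.d0 d j)) ℂ := Matrix.of fun k r =>
    Z⁻¹ (Sum.inl k) ((streamEquiv L d j).symm r)
  have hT : ∀ i, (Sr j * (U j * Tᴴ))ᴴ * L.Hs H j i * Matrix.of (W i) =
      T * ((U j)ᴴ * (Sr j)ᴴ * L.Hs H j i * Matrix.of (W i)) := fun i => by
    simp only [Matrix.conjTranspose_mul, Matrix.conjTranspose_conjTranspose, Matrix.mul_assoc]
  have key : ∀ (k : Fin (d j)) (c : L.Streams d j),
      (T * ((U j)ᴴ * (Sr j)ᴴ * L.Hs H j (streamTx j c) * Matrix.of (W (streamTx j c)))) k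
        (streamIdx j c) = (1 : Matrix (L.Streams d j) (L.Streams d j) ℂ) (Sum.inl k) c := by
    intro k c
    rw [← Matrix.nonsing_inv_mul Z hdet.isUnit, Matrix.mul_apply, Matrix.mul_apply,
      ← (streamEquiv L d j).sum_comp]
    refine Finset.sum_congr rfl fun r _ => ?_
    simp only [T, Matrix.of_apply, Equiv.symm_apply_apply]
    rfl
  refine ⟨U j * Tᴴ, ?_, fun i hi => ?_⟩
  · rw [hT]
    ext k k'
    refine (key k (Sum.inl k')).trans ?_
    simp [Matrix.one_apply]
  · have hcov : i ∈ L.ΩI j ∪ L.ΩII j ∪ L.ΩIII j ∪ L.ΩIV j := by rw [L.cover j]; simp [hi]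
    simp only [Finset.mem_union] at hcov
    rw [hT]
    rcases hcov with ((h1 | h2) | h3) | h4
    · ext k k'
      refine (key k (Sum.inr ⟨⟨i, h1⟩, k'⟩)).trans ?_
      simp
    · rw [Matrix.mul_assoc (U j)ᴴ, h.1 j i h2]; simp
    · rw [Matrix.mul_assoc (U j)ᴴ, Matrix.mul_assoc (U j)ᴴ, h.2.1 j i h3]; simp
    · rw [Matrix.mul_assoc (U j)ᴴ, h.2.2 j i h4]; simp

theorem padRows_first {n k n' : ℕ} (h : n ≤ n') (A : Matrix (Fin n) (Fin k) ℂ) (r : Fin n)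
    (c : Fin k) : padRows n' A (firstIdx h r) c = A r c := by
  simp [padRows, firstIdx]

theorem padRows_last {n k n' : ℕ} (h : n ≤ n') (A : Matrix (Fin n) (Fin k) ℂ)
    (r : Fin (n' - n)) (c : Fin k) : padRows n' A (lastIdx h r) c = 0 := by
  simp [padRows, lastIdx]

/-- Padded transceivers only see the submatrices `H_{ji}^s`. -/
theorem padRows_mul_mul_padRows (H : Channel M N) (j i : Fin K) {k k' : ℕ}
    (B : Matrix (Fin (L.Ms j)) (Fin k) ℂ) (W : Matrix (Fin (L.Ns i)) (Fin k') ℂ) :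
    (padRows (M j) B)ᴴ * Matrix.of (H j i) * padRows (N i) W = Bᴴ * L.Hs H j i * W := by
  ext a b
  rw [Matrix.mul_apply, sum_eq_first_add_last (L.Ns_le i), Matrix.mul_apply]
  simp only [padRows_first, padRows_last, mul_zero, Finset.sum_const_zero, add_zero]
  refine Finset.sum_congr rfl fun c _ => ?_
  congr 1
  rw [Matrix.mul_apply, sum_eq_first_add_last (L.Ms_le j), Matrix.mul_apply]
  simp only [Matrix.conjTranspose_apply, padRows_first, padRows_last, star_zero, zero_mul,
    Finset.sum_const_zero, add_zero]
  rfl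

open Classical in
/-- The decorrelator that cancels all received interference and keeps the desired
streams, whenever there is one. -/
noncomputable def zeroForcing (M d : Fin K → ℕ) : DecorrelationRule M d := fun j R =>
  if h : ∃ U : Matrix (Fin (M j)) (Fin (d j)) ℂ, (Uᴴ * R j).rank = d j ∧
    ∀ i, i ≠ j → Uᴴ * R i = 0 then h.choose else 0

theorem aligns_zeroForcing {H : Channel M N} {V : ∀ i : Fin K, Matrix (Fin (N i)) (Fin (d i)) ℂ}
    {U : ∀ j : Fin K, Matrix (Fin (M j)) (Fin (d j)) ℂ} (h : Aligns H V U) :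
    Aligns H V fun j => zeroForcing M d j fun i => Matrix.of (H j i) * V i := by
  have key : ∀ j, ∃ U : Matrix (Fin (M j)) (Fin (d j)) ℂ,
      (Uᴴ * (Matrix.of (H j j) * V j)).rank = d j ∧
        ∀ i, i ≠ j → Uᴴ * (Matrix.of (H j i) * V i) = 0 := fun j =>
    ⟨U j, by rw [← Matrix.mul_assoc]; exact h.1 j,
      fun i hi => by rw [← Matrix.mul_assoc]; exact h.2 i j hi⟩
  have hz : ∀ j, zeroForcing M d j (fun i => Matrix.of (H j i) * V i) = (key j).choose :=
    fun j => dif_pos (key j)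
  refine ⟨fun j => ?_, fun i j hij => ?_⟩
  · beta_reduce
    rw [hz, Matrix.mul_assoc]
    exact (key j).choose_spec.1
  · beta_reduce
    rw [hz, Matrix.mul_assoc]
    exact (key j).choose_spec.2 i hij

/-- Precoders, frames and filters that cancel the links of strategies II, III and IV solve the
alignment problem as soon as the remaining streams can be separated.  The frames `Sr₀` need not be
the ones that the receivers use for the feedback. -/
theorem solvesAt_of_cancelsAt {H : Channel M N} {W : L.Precoders d} {Sr₀ : L.RxFrames}
    {U : L.Filters d} (hfr : ∃ Sr St, L.IsFrames H Sr St) (hSr₀ : ∀ j, (Sr₀ j)ᴴ * Sr₀ j = 1)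
    (h : CancelsAt H W Sr₀ U) (hdet : ∀ j, (streamMatrix H W Sr₀ U j).det ≠ 0)
    {P : L.PrecodingRule d} (hP : ∀ Sr, L.IsRxFrames H Sr →
      P (L.feedback H Sr) = fun i => padRows (N i) (Matrix.of (W i))) :
    L.SolvesAt P (zeroForcing M d) H := by
  refine ⟨hfr, fun Sr St hS => ?_⟩
  have hr₀ : L.IsRxFrames H Sr₀ := WeakRx.isRxFrames ⟨hSr₀, h.1⟩ hS.1.finrank_le
  choose A hA hA' using fun j => h.exists_decorrelator (hdet j)
  choose C hC using hS.1.exists_eq_mul hr₀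
  have hR : ∀ R : ∀ j, Matrix (Fin (L.me j)) (Fin (L.me j)) ℂ, (∀ j, IsUnit (R j)) →
      ∃ Ua : ∀ j, Matrix (Fin (L.me j)) (Fin (d j)) ℂ,
        Aligns H (P (L.feedback H Sr)) fun j => padRows (M j) (Sr j * (R j)ᴴ * Ua j) := by
    intro R hR
    have hU : ∀ j, Sr j * (R j)ᴴ * (((R j)⁻¹)ᴴ * (C j * A j)) = Sr₀ j * A j := by
      intro j
      rw [Matrix.mul_assoc, ← Matrix.mul_assoc (R j)ᴴ, ← Matrix.conjTranspose_mul,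
        Matrix.nonsing_inv_mul _ ((Matrix.isUnit_iff_isUnit_det _).1 (hR j)),
        Matrix.conjTranspose_one, Matrix.one_mul, ← Matrix.mul_assoc, ← hC]
    refine ⟨fun j => ((R j)⁻¹)ᴴ * (C j * A j), ?_⟩
    rw [hP Sr hS.1]
    refine ⟨fun j => ?_, fun i j hij => ?_⟩
    · rw [padRows_mul_mul_padRows, hU, hA, Matrix.rank_one, Fintype.card_fin]
    · rw [padRows_mul_mul_padRows, hU, hA' j i hij]
  refine ⟨?_, ?_, hR⟩
  · obtain ⟨Ua, hUa⟩ := hR (fun _ => 1) fun _ => isUnit_one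
    exact aligns_zeroForcing hUa
  · have hV : ∀ i, ∃ Va : Matrix (Fin (L.ne i)) (Fin (d i)) ℂ, Matrix.of (W i) = St i * Va := by
      intro i
      refine exists_eq_mul_of_col_mem fun c => ?_
      rw [(hS.2 i).2, Submodule.mem_iInf]
      rintro ⟨j, hj⟩
      rw [hS.1.nullSpace_eq hr₀]
      exact forall_col_mem_nullSpace.2 (h.2.1 j i hj) c
    choose Va hVa using hV
    exact ⟨Va, fun i => by rw [hP Sr hS.1, ← hVa]⟩

/-- A measurable choice of precoders that depends on the channel only through the set
of possible precoders. -/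
theorem exists_measurable_precoder (hM : ∀ j, (L.d0 d j : ℤ) ≤ L.Me j)
    (hN : ∀ i, (d i : ℤ) ≤ L.Ne i) (hA : ∀ G : L.GFamily, AlignableIV d G) :
    ∃ s : Channel M N → L.Precoders d, Measurable s ∧ (∀ H, IsPrecoder H (s H)) ∧
      ∀ H H', (∀ W : L.Precoders d, IsPrecoder H W ↔ IsPrecoder H' W) → s H = s H' := by
  obtain ⟨s, hs, hsC, hsx⟩ := exists_measurable_selection (X := Channel M N)
    (E := L.Precoders d) isCompact_orthonormalPrecoders isClosed_isPrecoder
    (fun H W h => h.1)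
  exact ⟨s, hs, fun H => hsC H (exists_isPrecoder hM hN hA H), hsx⟩

/-- If the rows are independent for some family `G₀`, whether or not it comes from a channel, then
the alignment problem is solved by the precoders selected from the feedback and the zero forcing
decorrelators. -/
theorem exists_solvesAt (hM : ∀ j, (L.d0 d j : ℤ) ≤ L.Me j) (hN : ∀ i, (d i : ℤ) ≤ L.Ne i)
    {G₀ : L.GFamily} (h₀ : RowsIndependent hM hN G₀) :
    ∃ (P : L.PrecodingRule d) (D : DecorrelationRule M d),
      ∀ᵐ H ∂channelLaw M N, L.SolvesAt P D H := by
  classical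
  obtain ⟨s, hs, hsP, hsx⟩ := exists_measurable_precoder hM hN
    (fun G => alignableIV_of_rowsIndependent hM hN h₀ G)
  -- any channel with feedback `F` has the same set of precoders, and hence the same selected one
  let P : L.PrecodingRule d := fun F i =>
    if h : ∃ (H : Channel M N) (Sr : L.RxFrames), L.IsRxFrames H Sr ∧ L.feedback H Sr = F then
      padRows (N i) (Matrix.of (s h.choose i))
    else 0
  have hP : ∀ H Sr, L.IsRxFrames H Sr →
      P (L.feedback H Sr) = fun i => padRows (N i) (Matrix.of (s H i)) := by
    intro H Sr hSr
    have hex : ∃ (H' : Channel M N) (Sr' : L.RxFrames),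
        L.IsRxFrames H' Sr' ∧ L.feedback H' Sr' = L.feedback H Sr := ⟨H, Sr, hSr, rfl⟩
    obtain ⟨Sr', hSr', hF⟩ := hex.choose_spec
    have hsH : s hex.choose = s H := hsx _ _ fun W => by
      rw [isPrecoder_iff_feedback hSr', isPrecoder_iff_feedback hSr, hF]
    funext i
    rw [← hsH]
    exact dif_pos hex
  -- the selected precoders do not depend on the direct and the strategy I links
  have hmix : ∀ H H' : Channel M N,
      s (mix (fun j => L.ΩII j ∪ L.ΩIII j ∪ L.ΩIV j) H H') = s H := by
    intro H H'
    have hHs : ∀ j, ∀ i ∈ L.ΩII j ∪ L.ΩIII j ∪ L.ΩIV j,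
        L.Hs (mix (fun j => L.ΩII j ∪ L.ΩIII j ∪ L.ΩIV j) H H') j i = L.Hs H j i :=
      fun j i hi => Hs_mix_of_mem (A := fun j => L.ΩII j ∪ L.ΩIII j ∪ L.ΩIV j) hi
    exact hsx _ _ fun W =>
      ⟨fun h => h.congr hHs, fun h => h.congr fun j i hi => (hHs j i hi).symm⟩
  have hex : ∀ᵐ H ∂channelLaw M N, ∃ y ∈ orthonormalFrameFilters L d,
      (∀ H', ((mix (fun j => L.ΩII j ∪ L.ΩIII j ∪ L.ΩIV j) H H', s H), y) ∈
        {p : (Channel M N × L.Precoders d) × (L.RxFrames × L.Filters d) |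
          CancelsAt p.1.1 p.1.2 p.2.1 p.2.2}) ∧
      ∃ H', ∏ j, (streamMatrix (mix (fun j => L.ΩII j ∪ L.ΩIII j ∪ L.ΩIV j) H H') (s H)
        y.1 y.2 j).det ≠ 0 := by
    refine .of_forall fun H => ?_
    obtain ⟨hW, y, hy, hc⟩ := hsP H
    obtain ⟨H', hH'⟩ := exists_streamMatrix_mix_eq_one hW hy.1 hy.2 H
    refine ⟨y, hy, fun H' => hc.congr fun j i hi =>
      (Hs_mix_of_mem (A := fun j => L.ΩII j ∪ L.ΩIII j ∪ L.ΩIV j) hi).symm, H', ?_⟩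
    refine Finset.prod_ne_zero_iff.2 fun j _ => ?_
    rw [hH' j, Matrix.det_one]
    exact one_ne_zero
  have key := ae_exists_of_mix (M := M) (N := N) (fun j => L.ΩII j ∪ L.ΩIII j ∪ L.ΩIV j)
    (T := L.Precoders d) (Y := L.RxFrames × L.Filters d) hs (.of_forall hmix)
    isCompact_orthonormalFrameFilters isClosed_cancelsAt continuous_det_streamMatrix
    (fun t y => differentiable_det_streamMatrix t y.1 y.2) hex
  refine ⟨P, zeroForcing M d, ?_⟩
  filter_upwards [key, ae_exists_isFrames hM hN] with H hH hfr
  obtain ⟨y, hy, hc, hdet⟩ := hH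
  exact solvesAt_of_cancelsAt hfr hy.1 hc
    (fun j => Finset.prod_ne_zero_iff.1 hdet j (Finset.mem_univ j)) (hP H)

end Profile

end IA

/-! ### Feasibility and genericity -/

theorem theorem2 {K : ℕ} (M N d : Fin K → ℕ) (L : IA.Profile M N)
    (hN : ∀ i, (d i : ℤ) ≤ L.Ne i) (hM : ∀ j, (L.d0 d j : ℤ) ≤ L.Me j) :
    -- linear independence of the rows of the `X_{ji}` suffices
    (∃ (P : L.PrecodingRule d) (D : IA.DecorrelationRule M d),
      ∀ᵐ H ∂IA.channelLaw M N,
        IA.Profile.IndependentAt (L := L) hM hN H → L.SolvesAt P D H) ∧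
    -- linear independence is a generic property
    (((∀ᵐ H ∂IA.channelLaw M N, IA.Profile.IndependentAt (L := L) hM hN H) ∧
        ∀ S : L.FrameRule, ∀ᵐ H ∂IA.channelLaw M N,
          IA.Profile.RowsIndependent hM hN (L.G H (S.Sr H) (S.St H) fun _ => 1)) ∨
      ∀ᵐ H ∂IA.channelLaw M N, ¬ IA.Profile.IndependentAt (L := L) hM hN H) ∧
    -- linear independence at one single realization suffices
    (∀ H₀ : IA.Channel M N, IA.Profile.IndependentAt (L := L) hM hN H₀ →
      (∀ᵐ H ∂IA.channelLaw M N, IA.Profile.IndependentAt (L := L) hM hN H) ∧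
      ∃ (P : L.PrecodingRule d) (D : IA.DecorrelationRule M d),
        ∀ᵐ H ∂IA.channelLaw M N, L.SolvesAt P D H) := by
  by_cases hG : ∃ G₀ : L.GFamily, IA.Profile.RowsIndependent hM hN G₀
  · obtain ⟨G₀, h₀⟩ := hG
    obtain ⟨P, D, hPD⟩ := IA.Profile.exists_solvesAt hM hN h₀
    have hI := IA.Profile.ae_independentAt hM hN h₀
    exact ⟨⟨P, D, hPD.mono fun H hH _ => hH⟩,
      Or.inl ⟨hI, fun S => S.ae_rowsIndependent hM hN h₀⟩, fun _ _ => ⟨hI, P, D, hPD⟩⟩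
  · have hno : ∀ H, ¬ IA.Profile.IndependentAt (L := L) hM hN H :=
      fun H ⟨_, _, _, _, _, h⟩ => hG ⟨_, h⟩
    exact ⟨⟨fun _ _ => 0, fun _ _ => 0, .of_forall fun H h => absurd h (hno H)⟩,
      Or.inr (.of_forall hno), fun H₀ h => absurd h (hno H₀)⟩
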